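/- In the LOCAL model of computation, each node of an $n$-vertex graph $G$ has a unique identifier (an integer between $1$ and $n$); initially it knows only $n$, its own identifier and its own input, and in each synchronous round it exchanges messages of unbounded size with its neighbours and performs unbounded local computation. The round complexity of an algorithm is the number of rounds it takes for each node to choose its output. A family $L=(L(v))_{v\in V(G)}$ of finite lists of colours is a $k$-list-assignment if $|L(v)|\ge k$ for every vertex $v$, and an $L$-list-colouring of $G$ is a proper colouring $c$ of $G$ with $c(v)\in L(v)$ for every vertex $v$. There is an absolute constant $C>0$ such that, for every set of colours, there is a deterministic algorithm in the LOCAL model with the following property. Let $G$ be any $n$-vertex graph of maximum degree $\Delta\ge 3$, let $L$ be any $\Delta$-list-assignment for the vertices of $G$ with colours from this set, and let each node $v$ be given $\Delta$ and $L(v)$ as its input. Then within $C\,\Delta^2\log^3 n$ rounds every node outputs either a colour or the report that no list-colouring exists, and either the outputs form an $L$-list-colouring of $G$, or $G$ has no $L$-list-colouring and at least one node reports this. Moreover, for each connected component $K$ of $G$, either the outputs on $K$ form an $L$-list-colouring of $K$, or $K$ has no $L$-list-colouring and every node of $K$ reports this. -/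

import Mathlib

universe u v

/-- A deterministic algorithm in the LOCAL model, for nodes with local inputs in `I` and local
outputs in `O`. States and messages range over arbitrary types and the transition maps are
arbitrary functions: messages have unbounded size and nodes have unbounded computational power.
Initially a node knows only `n`, its own identifier and its own input. In each synchronous round
it sends a message to all of its neighbours, and then updates its state using
the messages that it receives from its neighbours. A node announces an output by entering a state
whose `output` is not `none`. -/
structure LocalAlgorithm (I O : Type u) where
  State : Type u
  Msg : Type u
  start : (n : ℕ) → (ident : ℕ) → (input : I) → State
  send : State → Msg
  receive : State → Multiset Msg → State
  output : State → Option O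

namespace LocalAlgorithm

variable {I O : Type u} {V : Type v} [Fintype V]

/-- The state of every node after `t` rounds of the execution of `A` on the network `G`, with
identifiers `ident` and local inputs `input`. -/
def state (A : LocalAlgorithm I O) (G : SimpleGraph V) [DecidableRel G.Adj]
    (ident : V → ℕ) (input : V → I) : ℕ → V → A.State
  | 0, v => A.start (Fintype.card V) (ident v) (input v)
  | t + 1, v => A.receive (A.state G ident input t v)
      ((G.neighborFinset v).val.map fun w => A.send (A.state G ident input t w))

/-- Within `T` rounds every node `v` has chosen its output, and this output is `out v`. The first
output that a node announces is its final choice. -/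
def OutputsWithin (A : LocalAlgorithm I O) (G : SimpleGraph V) [DecidableRel G.Adj]
    (ident : V → ℕ) (input : V → I) (T : ℕ) (out : V → O) : Prop :=
  ∀ v, ∃ t ≤ T, A.output (A.state G ident input t v) = some (out v) ∧
    ∀ s < t, A.output (A.state G ident input s v) = none

end LocalAlgorithm

/-- Unique identifiers between `1` and the number of nodes. -/
def IsIdentAssignment {V : Type v} [Fintype V] (ident : V → ℕ) : Prop :=
  Function.Injective ident ∧ ∀ v, 1 ≤ ident v ∧ ident v ≤ Fintype.card V

/-- `L` is a `k`-list-assignment: every list has at least `k` colours. -/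
def IsListAssignment {V : Type v} {α : Type u} (k : ℕ) (L : V → Finset α) : Prop :=
  ∀ v, k ≤ (L v).card

/-- `c` is an `L`-list-colouring of `G`. -/
def IsListColoring {V : Type v} {α : Type u} (G : SimpleGraph V) (L : V → Finset α)
    (c : V → α) : Prop :=
  (∀ v w, G.Adj v w → c v ≠ c w) ∧ ∀ v, c v ∈ L v

/-- `G` is `L`-list-colourable. -/
def IsListColorable {V : Type v} {α : Type u} (G : SimpleGraph V) (L : V → Finset α) : Prop :=
  ∃ c : V → α, IsListColoring G L c

/-- The output of a single node: either a colour, or the report that there is no list-colouring. -/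
inductive NodeOutput (α : Type u) : Type u
  | color (a : α) : NodeOutput α
  | noColoring : NodeOutput α

/-- The nodes output an `L`-list-colouring of `G`. -/
def FindsListColoring {V : Type v} {α : Type u} (G : SimpleGraph V) (L : V → Finset α)
    (out : V → NodeOutput α) : Prop :=
  ∃ c : V → α, IsListColoring G L c ∧ ∀ v, out v = NodeOutput.color (c v)

/-!
Every list has at least `Δ` colours, so a vertex can be coloured greedily as long as one of its
neighbours is still uncoloured. Hence the whole graph can be coloured from far to near with respect
to a set of roots, which leaves the problem of completing the colouring in disjoint, pairwise
non-adjacent balls around the roots. In such a ball the residual lists are at least as long as the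
degrees within the ball.

The point is that a ball of radius `R = 3 * Δ * J`, where `n < 2 ^ J`, either can be completed or is
a whole connected component (`Bad.ball_closed`). A connected set that is not degree-choosable
(`Bad`) passes this property on to its subsets (`Bad.exists_subset`), and without cut vertices it
is regular (`Bad.regular`). Removing end blocks one after the other then gives Gallai's bound
`Bad.degSum_le`: a connected set that is not degree-choosable, in a graph of maximum degree `Δ`, has
`Δ - 1 + 2 / Δ` as a bound on its average degree, unless it is `Δ`-regular. So if the ball of
radius `R` is bad and not closed, all vertices in it have degree `Δ`, and the smaller balls around
the same centre are left by so many edges that each is larger than the one before by a factor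
`1 + 1 / (3 * Δ)` (`card_ball_growth`); after `R` steps there would be more than `n` vertices. The
theorem of Brooks is not needed: in the exceptional case the ball is the component, and the root
decides by itself whether the component can be coloured.

The distributed side rests on `IsLocal T f`: the values `f` at the nodes are functions of their
views after `T` rounds. Such functions are closed under composition, iteration, and collecting
values in a ball, and the full-information algorithm computes them (`exists_localAlgorithm`). The roots form a
ruling set computed along the bits of the identifiers (`ruling`), ties between vertices at equal
distance from the roots are broken by a proper `Δ + 1`-colouring, also computed bit by
bit (`identColor`), and both this colouring and the colouring outside of the balls are instances of
`greedy`. With `J` about `log n`, balls of radius `O(Δ * J)` and roots within distance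
`O(Δ * J ^ 2)` make `O(Δ ^ 2 * J ^ 2)` rounds (`rounds_le`).
-/

set_option linter.unusedSectionVars false

namespace LocalBrooks

open Finset

/-! ### Sets that are not degree-choosable, and Gallai's bound -/

section Bad

variable {V : Type v} {α : Type u} [DecidableEq V] [DecidableEq α] {G : SimpleGraph V}
  [DecidableRel G.Adj]

/-- The degree of `x` into the vertex set `S`. -/
def degIn (G : SimpleGraph V) [DecidableRel G.Adj] (S : Finset V) (x : V) : ℕ :=
  #{y ∈ S | G.Adj x y}

/-- The subgraph induced on `S` is connected (or empty), phrased through cuts: every proper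
nonempty subset of `S` is left by an edge of `S`. -/
def Linked (G : SimpleGraph V) (S : Finset V) : Prop :=
  ∀ A ⊆ S, A.Nonempty → A ≠ S → ∃ a ∈ A, ∃ b ∈ S \ A, G.Adj a b

/-- The lists `L` witness that the subgraph induced on `S` is not degree-choosable: each list is
at least as long as the degree, and yet there is no list-colouring. -/
def Bad (G : SimpleGraph V) [DecidableRel G.Adj] (S : Finset V) (L : V → Finset α) : Prop :=
  (∀ x ∈ S, degIn G S x ≤ #(L x)) ∧
    ¬ ∃ c : V → α, ∀ x ∈ S, c x ∈ L x ∧ ∀ y ∈ S, G.Adj x y → c x ≠ c y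

lemma degIn_insert {S : Finset V} {w : V} (hw : w ∉ S) (x : V) :
    degIn G (insert w S) x = degIn G S x + if G.Adj x w then 1 else 0 := by
  unfold degIn
  rw [filter_insert]
  split_ifs with h
  · rw [card_insert_of_notMem (by simp [hw])]
  · simp

lemma degIn_mono {S T : Finset V} (h : S ⊆ T) (x : V) : degIn G S x ≤ degIn G T x :=
  card_le_card (filter_subset_filter _ h)

/-- Colouring one vertex and deleting its colour from the lists of its neighbours keeps the
lists bad. -/
lemma Bad.delete {S : Finset V} {L : V → Finset α} {w : V} (h : Bad G (insert w S) L)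
    (hw : w ∉ S) {a : α} (ha : a ∈ L w) :
    Bad G S (fun x => if G.Adj w x then (L x).erase a else L x) := by
  refine ⟨fun x hx => ?_, ?_⟩
  · have h1 := h.1 x (mem_insert_of_mem hx)
    rw [degIn_insert hw] at h1
    simp only [G.adj_comm w x]
    split_ifs at h1 ⊢ with hxw
    · have := pred_card_le_card_erase (s := L x) (a := a)
      omega
    · simpa using h1
  · rintro ⟨c, hc⟩
    apply h.2
    refine ⟨fun x => if x = w then a else c x, fun x hx => ?_⟩
    have key : ∀ x ∈ S, c x ∈ L x ∧ (G.Adj w x → c x ≠ a) := by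
      intro x hx
      have : c x ∈ if G.Adj w x then (L x).erase a else L x := (hc x hx).1
      split_ifs at this with hxw
      · exact ⟨mem_of_mem_erase this, fun _ => ne_of_mem_erase this⟩
      · exact ⟨this, fun h => absurd h hxw⟩
    have hne : ∀ x ∈ S, x ≠ w := fun x hx h => hw (h ▸ hx)
    rcases mem_insert.1 hx with rfl | hx
    · refine ⟨by simpa using ha, fun y hy hxy => ?_⟩
      rcases mem_insert.1 hy with rfl | hy
      · exact absurd hxy (G.loopless.irrefl _)
      · simp only [if_true, if_neg (hne y hy)]
        exact ((key y hy).2 hxy).symm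
    · simp only [if_neg (hne x hx)]
      refine ⟨(key x hx).1, fun y hy hxy => ?_⟩
      rcases mem_insert.1 hy with rfl | hy
      · simpa using (key x ‹_›).2 hxy.symm
      · simpa only [if_neg (hne y hy)] using (hc x hx).2 y hy hxy

/-- Badness passes to nonempty subsets of connected sets, and the slack `#(L x) - degIn G S x`
does not decrease. -/
lemma Bad.exists_subset {S T : Finset V} {L : V → Finset α} (hS : Linked G S) (h : Bad G S L)
    (hT : T ⊆ S) (hne : T.Nonempty) :
    ∃ L' : V → Finset α, Bad G T L' ∧
      ∀ x ∈ T, #(L x) + degIn G T x ≤ #(L' x) + degIn G S x := by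
  induction hk : #(S \ T) generalizing T with
  | zero =>
    have : S ⊆ T := by rwa [card_eq_zero, sdiff_eq_empty_iff_subset] at hk
    obtain rfl := hT.antisymm this
    exact ⟨L, h, fun x _ => le_rfl⟩
  | succ k ih =>
    have hTS : T ≠ S := by rintro rfl; simp at hk
    obtain ⟨a, ha, b, hb, hab⟩ := hS T hT hne hTS
    obtain ⟨hbS, hbT⟩ := mem_sdiff.1 hb
    have hcard : #(S \ insert b T) = k := by
      rw [sdiff_insert, card_erase_of_mem hb]; omega
    obtain ⟨L', hL', hle⟩ := ih (insert_subset hbS hT) (insert_nonempty _ _) hcard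
    have hpos : 0 < #(L' b) := by
      refine lt_of_lt_of_le ?_ (hL'.1 b (mem_insert_self _ _))
      exact card_pos.2 ⟨a, by simp [ha, hab.symm]⟩
    obtain ⟨q, hq⟩ := card_pos.1 hpos
    refine ⟨_, hL'.delete hbT hq, fun x hx => ?_⟩
    have h1 := hle x (mem_insert_of_mem hx)
    rw [degIn_insert hbT] at h1
    simp only [G.adj_comm b x]
    split_ifs at h1 ⊢ with hxw
    · have := pred_card_le_card_erase (s := L' x) (a := q)
      omega
    · omega

/-- In a connected set, bad lists are exactly as long as the degrees. -/
lemma Bad.card_eq {S : Finset V} {L : V → Finset α} (hS : Linked G S) (h : Bad G S L) {x : V}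
    (hx : x ∈ S) : #(L x) = degIn G S x := by
  refine le_antisymm ?_ (h.1 x hx)
  by_contra! hlt
  obtain ⟨L', hL', hle⟩ := h.exists_subset hS (singleton_subset_iff.2 hx) (singleton_nonempty x)
  have h1 := hle x (mem_singleton_self x)
  have hpos : 0 < #(L' x) := by omega
  obtain ⟨q, hq⟩ := card_pos.1 hpos
  apply hL'.2
  refine ⟨fun _ => q, fun y hy => ?_⟩
  obtain rfl := mem_singleton.1 hy
  refine ⟨hq, fun z hz hyz => ?_⟩
  obtain rfl := mem_singleton.1 hz
  exact absurd hyz (G.loopless.irrefl _)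

/-- The list of a vertex that is not a cut vertex is contained in those of its neighbours: a
colour missing from the list of a neighbour would give that neighbour a list longer than its
degree, once it has been used at the vertex. -/
lemma Bad.list_subset {S : Finset V} {L : V → Finset α} (h : Bad G S L)
    {w x : V} (hw : w ∈ S) (hx : x ∈ S) (hwx : G.Adj w x) (hcut : Linked G (S.erase w)) :
    L w ⊆ L x := by
  intro a ha
  by_contra hax
  rw [← insert_erase hw] at h
  have hx' : x ∈ S.erase w := mem_erase.2 ⟨hwx.ne', hx⟩
  have h1 := (h.delete (notMem_erase w S) ha).card_eq hcut hx'
  have h2 := h.1 x (mem_insert_of_mem hx')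
  rw [degIn_insert (notMem_erase w S), if_pos hwx.symm] at h2
  rw [if_pos hwx, erase_eq_of_notMem hax] at h1
  omega

lemma Bad.regular {S : Finset V} {L : V → Finset α} (hS : Linked G S) (h : Bad G S L)
    (hcut : ∀ w ∈ S, Linked G (S.erase w)) {x y : V} (hx : x ∈ S) (hy : y ∈ S) :
    degIn G S x = degIn G S y := by
  by_contra hxy
  obtain ⟨a, ha, b, hb, hab⟩ := hS {z ∈ S | degIn G S z = degIn G S x} (filter_subset _ _)
    ⟨x, by simp [hx]⟩ (fun he => hxy (by
      have := he ▸ hy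
      exact (mem_filter.1 this).2.symm))
  simp only [mem_filter, mem_sdiff, not_and] at ha hb
  apply hb.2 hb.1
  rw [← ha.2, ← h.card_eq hS ha.1, ← h.card_eq hS hb.1]
  exact congrArg card ((h.list_subset hb.1 ha.1 hab.symm (hcut b hb.1)).antisymm
    (h.list_subset ha.1 hb.1 hab (hcut a ha.1)))

/-- Removing `x` from `S` splits off the proper part `A`; thus `x` is a cut vertex of `S`. -/
def SplitsOff (G : SimpleGraph V) (S : Finset V) (x : V) (A : Finset V) : Prop :=
  x ∈ S ∧ A ⊆ S.erase x ∧ A.Nonempty ∧ A ≠ S.erase x ∧ ∀ a ∈ A, ∀ b ∈ S.erase x \ A, ¬ G.Adj a b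

lemma exists_splitsOff {S : Finset V} {x : V} (hx : x ∈ S) (h : ¬ Linked G (S.erase x)) :
    ∃ A, SplitsOff G S x A := by
  unfold Linked at h
  push Not at h
  obtain ⟨A, h1, h2, h3, h4⟩ := h
  exact ⟨A, hx, h1, h2, h3, h4⟩

lemma SplitsOff.compl {S : Finset V} {x : V} {A : Finset V} (h : SplitsOff G S x A) :
    SplitsOff G S x (S.erase x \ A) := by
  obtain ⟨hx, hA, hne, hne', hadj⟩ := h
  refine ⟨hx, sdiff_subset, ?_, ?_, ?_⟩
  · rw [sdiff_nonempty]
    exact fun h => hne' (hA.antisymm h)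
  · intro h
    obtain ⟨a, ha⟩ := hne
    have := h ▸ hA ha
    exact (mem_sdiff.1 this).2 ha
  · intro a ha b hb hab
    rw [Finset.sdiff_sdiff_eq_self hA] at hb
    exact hadj b hb a ha hab.symm

lemma SplitsOff.linked_sdiff {S : Finset V} (hS : Linked G S) {x : V} {A : Finset V}
    (h : SplitsOff G S x A) : Linked G (S \ A) := by
  obtain ⟨hx, hA, hne, hne', hadj⟩ := h
  have hxA : x ∉ A := fun h => by simpa using hA h
  intro B hB hBne hBne'
  have hBS : B ⊆ S := hB.trans sdiff_subset
  by_cases hxB : x ∈ B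
  · obtain ⟨a, ha, b, hb, hab⟩ := hS (B ∪ A) (union_subset hBS (hA.trans (erase_subset _ _)))
      (hBne.mono subset_union_left) (fun he => hBne' (by
        apply hB.antisymm
        intro z hz
        rw [← he] at hz
        simp only [mem_sdiff, mem_union] at hz
        tauto))
    simp only [mem_sdiff, mem_union, not_or] at ha hb
    refine ⟨a, ?_, b, by simp [hb], hab⟩
    rcases ha with ha | ha
    · exact ha
    · refine absurd hab (hadj a ha b ?_)
      simp only [mem_sdiff, mem_erase]
      exact ⟨⟨fun h => hb.2.1 (h ▸ hxB), hb.1⟩, hb.2.2⟩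
  · obtain ⟨a, ha, b, hb, hab⟩ := hS B hBS hBne (fun he => hxB (he ▸ hx))
    simp only [mem_sdiff] at hb
    refine ⟨a, ha, b, ?_, hab⟩
    simp only [mem_sdiff]
    refine ⟨⟨hb.1, fun hbA => ?_⟩, hb.2⟩
    refine hadj b hbA a ?_ hab.symm
    have := mem_sdiff.1 (hB ha)
    simp only [mem_sdiff, mem_erase]
    exact ⟨⟨fun h => hxB (h ▸ ha), this.1⟩, this.2⟩

lemma SplitsOff.linked_insert {S : Finset V} (hS : Linked G S) {x : V} {A : Finset V}
    (h : SplitsOff G S x A) : Linked G (insert x A) := by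
  have := h.compl.linked_sdiff hS
  convert this using 1
  ext z
  have h1 := h.1
  have h2 := @(h.2.1)
  have h3 : z ∈ A → z ∈ S := fun hz => mem_of_mem_erase (h2 hz)
  simp only [mem_insert, mem_sdiff, mem_erase]
  by_cases hz : z = x
  · subst hz; simp [h1]
  · simp only [hz]; tauto

/-- A smallest part that can be split off by a cut vertex spans, together with this vertex, an
end block. -/
lemma SplitsOff.linked_erase_of_minimal {S : Finset V} {x : V} {A : Finset V}
    (h : SplitsOff G S x A) (hmin : ∀ y B, SplitsOff G S y B → #A ≤ #B) {z : V}
    (hz : z ∈ insert x A) : Linked G ((insert x A).erase z) := by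
  obtain ⟨hx, hA, hne, hne', hadj⟩ := h
  have hxA : x ∉ A := fun h => by simpa using hA h
  have hAS : A ⊆ S := hA.trans (erase_subset _ _)
  have hnb : ∀ a ∈ A, ∀ b ∈ S, G.Adj a b → b ∈ insert x A := by
    intro a ha b hb hab
    by_contra hb'
    rw [mem_insert, not_or] at hb'
    exact hadj a ha b (by simp [hb, hb']) hab
  by_contra hcon
  obtain ⟨C, hC⟩ := exists_splitsOff hz hcon
  -- one of `C` and its complement avoids `x`
  obtain ⟨C, hC, hxC⟩ : ∃ C, SplitsOff G (insert x A) z C ∧ x ∉ C := by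
    by_cases hxC : x ∈ C
    · exact ⟨_, hC.compl, fun h => (mem_sdiff.1 h).2 hxC⟩
    · exact ⟨C, hC, hxC⟩
  obtain ⟨-, hCsub, hCne, hCne', hCadj⟩ := hC
  have hCA : C ⊆ A := by
    intro c hc
    rcases mem_insert.1 (mem_of_mem_erase (hCsub hc)) with rfl | h
    · exact absurd hc hxC
    · exact h
  have hzC : z ∉ C := fun h => by simpa using hCsub h
  have hzS : z ∈ S := by
    rcases mem_insert.1 hz with rfl | h
    · exact hx
    · exact hAS h
  have hCS : C ⊆ S.erase z := fun c hc =>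
    mem_erase.2 ⟨fun h => hzC (h ▸ hc), hAS (hCA hc)⟩
  have hCA' : C ≠ A := by
    rintro rfl
    rcases mem_insert.1 hz with rfl | h
    · exact hCne' (by rw [erase_insert hxA])
    · exact hzC h
  have hlt : #C < #A := card_lt_card (hCA.ssubset_of_ne hCA')
  have hsplit : SplitsOff G S z C := by
    refine ⟨hzS, hCS, hCne, ?_, ?_⟩
    · rintro rfl
      obtain ⟨d, hd, hdC⟩ : ∃ d ∈ (insert x A).erase z, d ∉ S.erase z := by
        by_contra! hcon
        exact hCne' (hCsub.antisymm hcon)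
      rw [mem_erase, mem_insert] at hd
      exact hdC (mem_erase.2 ⟨hd.1, hd.2.elim (fun h => h ▸ hx) (fun h => hAS h)⟩)
    · intro a ha b hb hab
      rw [mem_sdiff, mem_erase] at hb
      refine hCadj a ha b ?_ hab
      rw [mem_sdiff, mem_erase]
      exact ⟨⟨hb.1.1, hnb a (hCA ha) b hb.1.2 hab⟩, hb.2⟩
  have := hmin z C hsplit
  omega

/-- The sum of the degrees in the subgraph induced on `S`. -/
def degSum (G : SimpleGraph V) [DecidableRel G.Adj] (S : Finset V) : ℕ := ∑ x ∈ S, degIn G S x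

lemma sum_adj_eq_degIn (S : Finset V) (x : V) :
    ∑ y ∈ S, (if G.Adj y x then 1 else 0) = degIn G S x := by
  rw [degIn, card_filter]
  exact sum_congr rfl fun y _ => by simp [G.adj_comm]

lemma degSum_insert {S : Finset V} {w : V} (hw : w ∉ S) :
    degSum G (insert w S) = degSum G S + 2 * degIn G S w := by
  unfold degSum
  rw [sum_insert hw]
  simp only [degIn_insert hw, sum_add_distrib, sum_adj_eq_degIn, SimpleGraph.irrefl,
    if_false]
  ring

lemma degIn_union {S T : Finset V} (h : Disjoint S T) (x : V) :
    degIn G (S ∪ T) x = degIn G S x + degIn G T x := by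
  unfold degIn
  rw [filter_union, card_union_of_disjoint (disjoint_filter_filter h)]

/-- The edges of `S` are those of the two parts that meet in the cut vertex. -/
lemma SplitsOff.degSum_eq {S : Finset V} {x : V} {A : Finset V} (h : SplitsOff G S x A) :
    degSum G S = degSum G (S \ A) + degSum G (insert x A) := by
  obtain ⟨hx, hA, hne, hne', hadj⟩ := h
  have hxA : x ∉ A := fun h => by simpa using hA h
  set B := S.erase x \ A with hB
  have hxB : x ∉ B := by simp [hB]
  have hdisj : Disjoint A B := disjoint_sdiff
  have hS : S = insert x (A ∪ B) := by
    rw [hB, union_sdiff_of_subset hA, insert_erase hx]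
  have hSA : S \ A = insert x B := by
    rw [hB, ← insert_erase hx, insert_sdiff_of_notMem _ hxA]
    simp
  have hAB : ∀ a ∈ A, degIn G B a = 0 := fun a ha => by
    rw [degIn, card_eq_zero, filter_eq_empty_iff]
    exact fun b hb => hadj a ha b hb
  have hBA : ∀ b ∈ B, degIn G A b = 0 := fun b hb => by
    rw [degIn, card_eq_zero, filter_eq_empty_iff]
    exact fun a ha hab => hadj a ha b hb hab.symm
  rw [hSA, hS, degSum_insert (by simp [hxA, hxB]), degSum_insert hxA, degSum_insert hxB,
    degIn_union hdisj]
  have : degSum G (A ∪ B) = degSum G A + degSum G B := by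
    unfold degSum
    rw [sum_union hdisj]
    congr 1
    · exact sum_congr rfl fun a ha => by rw [degIn_union hdisj, hAB a ha, add_zero]
    · exact sum_congr rfl fun b hb => by rw [degIn_union hdisj, hBA b hb, zero_add]
  rw [this]; ring

lemma degIn_lt_card {S : Finset V} {x : V} (hx : x ∈ S) : degIn G S x < #S := by
  refine card_lt_card ⟨filter_subset _ _, fun h => ?_⟩
  simpa using h hx

lemma Linked.exists_adj {S : Finset V} (hS : Linked G S) {x : V} (hx : x ∈ S) (hne : S ≠ {x}) :
    ∃ y ∈ S, G.Adj x y := by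
  obtain ⟨a, ha, b, hb, hab⟩ := hS {x} (by simpa using hx) (by simp) (Ne.symm hne)
  obtain rfl := mem_singleton.1 ha
  exact ⟨b, (mem_sdiff.1 hb).1, hab⟩

/-- Gallai's bound on the number of edges of a Gallai tree of maximum degree at most `Δ`, here
for connected sets that are not degree-choosable. An end block `insert x A` is `k`-regular with
`k < Δ`, and we remove `A` if `k ≤ Δ - 2`, and the whole block if `k = Δ - 1`. -/
theorem Bad.degSum_le {Δ : ℕ} (hΔ : 3 ≤ Δ) {S : Finset V} (hS : Linked G S) (hne : S.Nonempty)
    {L : V → Finset α} (hbad : Bad G S L) (hdeg : ∀ x ∈ S, degIn G S x ≤ Δ)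
    (hlt : ∃ x ∈ S, degIn G S x < Δ) :
    Δ * degSum G S + Δ * #S + 2 * Δ ≤ Δ ^ 2 * #S + 2 * #S := by
  induction hn : #S using Nat.strong_induction_on generalizing S L with
  | _ n ih =>
  subst hn
  by_cases hcut : ∀ w ∈ S, Linked G (S.erase w)
  · obtain ⟨x, hx, hxΔ⟩ := hlt
    have hsum : degSum G S = #S * degIn G S x := by
      rw [degSum, sum_congr rfl (fun y hy => hbad.regular hS hcut hy hx)]
      simp
    have hm : degIn G S x < #S := degIn_lt_card hx
    rw [hsum]
    generalize degIn G S x = k at *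
    generalize #S = m at *
    obtain ⟨e, rfl⟩ : ∃ e, Δ = k + 1 + e := ⟨Δ - (k + 1), by omega⟩
    rcases e with _ | _ | e
    · nlinarith
    · nlinarith
    · nlinarith [Nat.mul_le_mul (show 1 ≤ m by omega) (le_refl ((k + 1 + (e + 1 + 1)) * (e + 2)))]
  · push Not at hcut
    obtain ⟨w, hw, hw'⟩ := hcut
    obtain ⟨A₀, hA₀⟩ := exists_splitsOff hw hw'
    obtain ⟨x, A, hA, hmin⟩ : ∃ x A, SplitsOff G S x A ∧
        ∀ y B, SplitsOff G S y B → #A ≤ #B := by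
      obtain ⟨p, hp, hmin⟩ := (InvImage.wf (fun p : V × Finset V => #p.2) Nat.lt_wfRel.wf).has_min
        {p | SplitsOff G S p.1 p.2} ⟨(w, A₀), hA₀⟩
      exact ⟨p.1, p.2, hp, fun y B hB => not_lt.1 (hmin (y, B) hB)⟩
    have hblock : ∀ z ∈ insert x A, Linked G ((insert x A).erase z) := fun z hz =>
      hA.linked_erase_of_minimal hmin hz
    have hB := hA.linked_insert hS
    have hS' := hA.linked_sdiff hS
    have hsum := hA.degSum_eq
    obtain ⟨hx, hAsub, hAne, hAne', hadj⟩ := hA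
    have hxA : x ∉ A := fun h => by simpa using hAsub h
    have hAS : A ⊆ S := hAsub.trans (erase_subset _ _)
    have hBS : insert x A ⊆ S := insert_subset hx hAS
    obtain ⟨LB, hLB, -⟩ := hbad.exists_subset hS hBS (insert_nonempty _ _)
    have hsumB : degSum G (insert x A) = #(insert x A) * degIn G A x := by
      rw [degSum, sum_congr rfl (fun y hy => hLB.regular hB hblock hy (mem_insert_self x A)),
        degIn_insert hxA]
      simp
    rw [card_insert_of_notMem hxA] at hsumB
    have hkA : degIn G A x ≤ #A := card_le_card (filter_subset _ _)
    have hcard : #S = #(S \ A) + #A := (card_sdiff_add_card_eq_card hAS).symm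
    have hdegx : degIn G S x = degIn G (S \ A) x + degIn G A x := by
      rw [← degIn_union disjoint_sdiff_self_left, sdiff_union_of_subset hAS]
    have hxSA : x ∈ S \ A := mem_sdiff.2 ⟨hx, hxA⟩
    have hkpos : 0 < degIn G A x := by
      obtain ⟨y, hy, hxy⟩ := hB.exists_adj (mem_insert_self x A) (fun h => by
        have := congrArg card h
        rw [card_insert_of_notMem hxA, card_singleton] at this
        have := card_pos.2 hAne
        omega)
      refine card_pos.2 ⟨y, mem_filter.2 ⟨?_, hxy⟩⟩
      exact (mem_insert.1 hy).resolve_left hxy.ne'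
    obtain ⟨y, hy, hxy⟩ := hS'.exists_adj hxSA (fun h => hAne' (by
      apply hAsub.antisymm
      intro z hz
      by_contra hzA
      have : z ∈ S \ A := mem_sdiff.2 ⟨mem_of_mem_erase hz, hzA⟩
      rw [h, mem_singleton] at this
      exact ne_of_mem_erase hz this))
    have hypos : 0 < degIn G (S \ A) x := card_pos.2 ⟨y, mem_filter.2 ⟨hy, hxy⟩⟩
    have hxΔ := hdeg x hx
    have hApos := card_pos.2 hAne
    by_cases hk : degIn G A x + 2 ≤ Δ
    · obtain ⟨L', hL', -⟩ := hbad.exists_subset hS (sdiff_subset (t := A)) ⟨x, hxSA⟩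
      have := ih #(S \ A) (by omega) hS' ⟨x, hxSA⟩ hL'
        (fun z hz => (degIn_mono sdiff_subset z).trans (hdeg z (mem_sdiff.1 hz).1))
        ⟨x, hxSA, by omega⟩ rfl
      rw [hsum, hsumB, hcard]
      generalize degIn G A x = k at *
      generalize #A = a at *
      nlinarith [Nat.mul_le_mul (le_refl (Δ * a)) hk, Nat.mul_le_mul (le_refl Δ) hkA]
    · -- now `x` has exactly one neighbour outside of its end block
      have hk1 : degIn G A x + 1 = Δ := by omega
      have hx1 : degIn G (S \ A) x = 1 := by omega
      set T := (S \ A).erase x with hT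
      have hxT : x ∉ T := notMem_erase _ _
      have hins : insert x T = S \ A := insert_erase hxSA
      have hyT : y ∈ T := mem_erase.2 ⟨hxy.ne', hy⟩
      have hxT1 : degIn G T x = 1 := by
        rw [← hins, degIn_insert hxT] at hx1
        simpa using hx1
      have honly : ∀ z ∈ T, G.Adj x z → z = y := by
        intro z hz hxz
        exact card_le_one.1 hxT1.le z (mem_filter.2 ⟨hz, hxz⟩) y (mem_filter.2 ⟨hyT, hxy⟩)
      have hTS : T ⊆ S := (erase_subset _ _).trans sdiff_subset
      have hTlinked : Linked G T := by
        intro C hC hCne hCT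
        have hxC : x ∉ C := fun h => hxT (hC h)
        by_cases hyC : y ∈ C
        · obtain ⟨a, ha, b, hb, hab⟩ := hS' (insert x C)
            (insert_subset hxSA (hC.trans (erase_subset _ _))) (insert_nonempty _ _)
            (fun h => hCT (by rw [← erase_insert hxC, h]))
          rw [← hins] at hb
          simp only [mem_sdiff, mem_insert, not_or] at ha hb
          have hbT : b ∈ T := hb.1.resolve_left hb.2.1
          refine ⟨a, ?_, b, mem_sdiff.2 ⟨hbT, hb.2.2⟩, hab⟩
          rcases ha with rfl | ha
          · exact absurd (honly b hbT hab ▸ hyC) hb.2.2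
          · exact ha
        · obtain ⟨a, ha, b, hb, hab⟩ := hS' C (hC.trans (erase_subset _ _)) hCne
            (fun h => hyC (h ▸ hy))
          rw [← hins] at hb
          simp only [mem_sdiff, mem_insert] at hb
          refine ⟨a, ha, b, mem_sdiff.2 ⟨hb.1.resolve_left ?_, hb.2⟩, hab⟩
          rintro rfl
          exact hyC (honly a (hC ha) hab.symm ▸ ha)
      obtain ⟨L', hL', -⟩ := hbad.exists_subset hS hTS ⟨y, hyT⟩
      have hyS : degIn G T y < degIn G S y := by
        have h1 := degIn_insert (G := G) hxT y
        have h2 := degIn_mono (G := G) (hins ▸ sdiff_subset : insert x T ⊆ S) y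
        rw [if_pos hxy.symm] at h1
        omega
      have hTcard : #(S \ A) = #T + 1 := by rw [← hins, card_insert_of_notMem hxT]
      have := ih #T (by omega) hTlinked ⟨y, hyT⟩ hL'
        (fun z hz => (degIn_mono hTS z).trans (hdeg z (hTS hz)))
        ⟨y, hyT, hyS.trans_le (hdeg y (hTS hyT))⟩ rfl
      rw [hsum, hsumB, hcard, hTcard, ← hins, degSum_insert hxT, hxT1]
      generalize degIn G A x = k at *
      generalize #A = a at *
      subst hk1
      nlinarith

end Bad

/-! ### Distances -/

section Within

variable {V : Type v} {G : SimpleGraph V} {u v w : V} {k l : ℕ}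

/-- The vertices `v` and `w` are at distance at most `k`. -/
def Within (G : SimpleGraph V) (k : ℕ) (v w : V) : Prop := ∃ p : G.Walk v w, p.length ≤ k

lemma Within.refl (G : SimpleGraph V) (k : ℕ) (v : V) : Within G k v v := ⟨.nil, Nat.zero_le _⟩

lemma Within.symm (h : Within G k v w) : Within G k w v := by
  obtain ⟨p, hp⟩ := h
  exact ⟨p.reverse, by simpa using hp⟩

lemma within_comm : Within G k v w ↔ Within G k w v := ⟨Within.symm, Within.symm⟩

lemma Within.trans (h : Within G k u v) (h' : Within G l v w) : Within G (k + l) u w := by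
  obtain ⟨p, hp⟩ := h
  obtain ⟨q, hq⟩ := h'
  exact ⟨p.append q, by rw [SimpleGraph.Walk.length_append]; omega⟩

lemma Within.mono (hkl : k ≤ l) (h : Within G k v w) : Within G l v w := by
  obtain ⟨p, hp⟩ := h
  exact ⟨p, hp.trans hkl⟩

lemma Within.of_adj (h : G.Adj v w) : Within G 1 v w := ⟨.cons h .nil, by simp⟩

lemma Within.reachable (h : Within G k v w) : G.Reachable v w := ⟨h.choose⟩

@[simp] lemma within_zero : Within G 0 v w ↔ v = w := by
  refine ⟨?_, ?_⟩
  · rintro ⟨p, hp⟩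
    exact SimpleGraph.Walk.eq_of_length_eq_zero (Nat.le_zero.1 hp)
  · rintro rfl
    exact Within.refl _ _ _

lemma within_succ : Within G (k + 1) v w ↔ Within G k v w ∨ ∃ u, G.Adj v u ∧ Within G k u w := by
  refine ⟨?_, ?_⟩
  · rintro ⟨p, hp⟩
    cases p with
    | nil => exact .inl (Within.refl _ _ _)
    | cons h q => exact .inr ⟨_, h, q, by simpa using hp⟩
  · rintro (h | ⟨u, h, q, hq⟩)
    · exact h.mono (Nat.le_succ _)
    · exact ⟨.cons h q, by simpa using hq⟩

lemma within_succ' : Within G (k + 1) v w ↔ Within G k v w ∨ ∃ u, Within G k v u ∧ G.Adj u w := by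
  rw [within_comm, within_succ, within_comm]
  refine or_congr Iff.rfl (exists_congr fun u => ?_)
  rw [and_comm, G.adj_comm, within_comm]

/-- A walk that leaves a set `A` does so along an edge. -/
lemma Within.exists_exit {A : Set V} (hv : v ∈ A) (hw : w ∉ A) (h : Within G k v w) :
    ∃ a ∈ A, ∃ b ∉ A, Within G k v a ∧ Within G k v b ∧ G.Adj a b := by
  induction k generalizing w with
  | zero => exact absurd (within_zero.1 h ▸ hv) hw
  | succ k ih =>
    have lift : (∃ a ∈ A, ∃ b ∉ A, Within G k v a ∧ Within G k v b ∧ G.Adj a b) →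
        ∃ a ∈ A, ∃ b ∉ A, Within G (k + 1) v a ∧ Within G (k + 1) v b ∧ G.Adj a b := by
      rintro ⟨a, ha, b, hb, h1, h2, h3⟩
      exact ⟨a, ha, b, hb, h1.mono (Nat.le_succ _), h2.mono (Nat.le_succ _), h3⟩
    rcases within_succ'.1 h with h' | ⟨u, hu, huw⟩
    · exact lift (ih hw h')
    · by_cases huA : u ∈ A
      · exact ⟨u, huA, w, hw, hu.mono (Nat.le_succ _), h, huw⟩
      · exact lift (ih huA hu)

end Within

/-! ### Expansion of balls that cannot be coloured -/

section Expansion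

variable {V : Type v} {α : Type u} [Fintype V] {G : SimpleGraph V}

open Classical in
/-- The ball of radius `k` around `v`. -/
noncomputable def ball (G : SimpleGraph V) (k : ℕ) (v : V) : Finset V := {w | Within G k v w}

@[simp] lemma mem_ball {k : ℕ} {v w : V} : w ∈ ball G k v ↔ Within G k v w := by simp [ball]

lemma ball_mono {k l : ℕ} (h : k ≤ l) (v : V) : ball G k v ⊆ ball G l v := fun _ hw =>
  mem_ball.2 ((mem_ball.1 hw).mono h)

lemma ball_nonempty (k : ℕ) (v : V) : (ball G k v).Nonempty := ⟨v, mem_ball.2 (Within.refl _ _ _)⟩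

variable [DecidableEq V]

lemma linked_ball (k : ℕ) (v : V) : Linked G (ball G k v) := by
  intro A hA hne hAk
  by_cases hv : v ∈ A
  · obtain ⟨b, hb, hbA⟩ : ∃ b ∈ ball G k v, b ∉ A := by
      by_contra! h
      exact hAk (hA.antisymm h)
    obtain ⟨a, ha, b, hb, -, h2, h3⟩ :=
      (mem_ball.1 hb).exists_exit (A := (A : Set V)) hv hbA
    exact ⟨a, ha, b, mem_sdiff.2 ⟨mem_ball.2 h2, hb⟩, h3⟩
  · obtain ⟨a, ha⟩ := hne
    obtain ⟨a, ha, b, hb, h1, -, h3⟩ :=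
      (mem_ball.1 (hA ha)).exists_exit (A := (A : Set V)ᶜ) hv (by simpa using ha)
    exact ⟨b, by simpa using hb, a, mem_sdiff.2 ⟨mem_ball.2 h1, ha⟩, h3.symm⟩

variable [DecidableEq α] [DecidableRel G.Adj]

lemma sum_degIn_comm (A C : Finset V) : ∑ x ∈ A, degIn G C x = ∑ y ∈ C, degIn G A y := by
  unfold degIn
  simp only [card_filter]
  rw [sum_comm]
  simp only [G.adj_comm]

lemma degIn_le_degree (S : Finset V) (x : V) : degIn G S x ≤ G.degree x := by
  rw [← G.card_neighborFinset_eq_degree]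
  exact card_le_card fun y hy => by simpa using (mem_filter.1 hy).2

lemma degIn_eq_degree {S : Finset V} {x : V} (h : ∀ y, G.Adj x y → y ∈ S) :
    degIn G S x = G.degree x := by
  rw [← G.card_neighborFinset_eq_degree, degIn]
  congr 1
  ext y
  simpa using h y

/-- Balls that are not degree-choosable grow by a factor `1 + 1 / (3 * Δ)`: by Gallai's bound
many edges leave such a ball. -/
lemma card_ball_growth {Δ : ℕ} (hΔ : 3 ≤ Δ) {v : V} {j : ℕ} {L : V → Finset α}
    (hbad : Bad G (ball G j v) L) (hdeg : ∀ x, G.degree x ≤ Δ)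
    (hreg : ∀ x ∈ ball G j v, G.degree x = Δ)
    (hopen : ∃ x ∈ ball G j v, ∃ y ∉ ball G j v, G.Adj x y) :
    (3 * Δ + 1) * #(ball G j v) ≤ 3 * Δ * #(ball G (j + 1) v) := by
  set B := ball G j v with hB
  set D := ball G (j + 1) v \ B with hD
  have hBsub : B ⊆ ball G (j + 1) v := ball_mono (Nat.le_succ j) v
  have hcard : #(ball G (j + 1) v) = #D + #B := (card_sdiff_add_card_eq_card hBsub).symm
  have hnb : ∀ x ∈ B, degIn G B x + degIn G D x = Δ := by
    intro x hx
    rw [← hreg x hx, ← degIn_union disjoint_sdiff, union_sdiff_of_subset hBsub]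
    exact degIn_eq_degree fun y hxy => mem_ball.2 (within_succ'.2 (.inr ⟨x, mem_ball.1 hx, hxy⟩))
  have hsum : degSum G B + ∑ x ∈ B, degIn G D x = #B * Δ := by
    rw [degSum, ← sum_add_distrib, sum_congr rfl hnb]
    simp
  have hDΔ : ∑ x ∈ B, degIn G D x ≤ #D * Δ := by
    rw [sum_degIn_comm]
    exact sum_le_card_nsmul D _ Δ fun y _ => (degIn_le_degree B y).trans (hdeg y)
  have hgal := hbad.degSum_le hΔ (linked_ball j v) (ball_nonempty j v)
    (fun x _ => (degIn_le_degree _ x).trans (hdeg x)) (by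
      obtain ⟨x, hx, y, hy, hxy⟩ := hopen
      refine ⟨x, hx, (?_ : degIn G B x < Δ)⟩
      have h1 := hnb x hx
      have h2 : 0 < degIn G D x := card_pos.2 ⟨y, mem_filter.2 ⟨mem_sdiff.2
        ⟨mem_ball.2 (within_succ'.2 (.inr ⟨x, mem_ball.1 hx, hxy⟩)), hy⟩, hxy⟩⟩
      omega)
  rw [← hB] at hgal
  rw [hcard]
  generalize #B = m at *
  generalize #D = d at *
  generalize degSum G B = e at *
  -- `Δ ≤ 3 * (Δ - 2)`
  have h1 : Δ * m ≤ Δ * (Δ * d) + 2 * m := by nlinarith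
  have h2 : Δ * m ≤ 3 * (Δ * (Δ * d)) := by nlinarith
  have h3 : m ≤ 3 * (Δ * d) := by
    refine Nat.le_of_mul_le_mul_left (c := Δ) ?_ (by omega)
    linarith
  linarith

/-- Bernoulli's inequality for `(1 + 1 / x) ^ x`, without division. -/
lemma two_mul_pow_le (x : ℕ) (hx : 0 < x) : 2 * x ^ x ≤ (x + 1) ^ x := by
  have h : ∀ k : ℕ, (x + k) * x ^ k ≤ x * (x + 1) ^ k := by
    intro k
    induction k with
    | zero => simp
    | succ k ih =>
      calc (x + (k + 1)) * x ^ (k + 1) ≤ (x + 1) * ((x + k) * x ^ k) := by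
            rw [pow_succ]; nlinarith [Nat.zero_le (k * x ^ k)]
        _ ≤ (x + 1) * (x * (x + 1) ^ k) := Nat.mul_le_mul le_rfl ih
        _ = x * (x + 1) ^ (k + 1) := by ring
  refine Nat.le_of_mul_le_mul_left (c := x) ?_ hx
  calc x * (2 * x ^ x) = (x + x) * x ^ x := by ring
    _ ≤ _ := h x

/-- A ball of logarithmic radius whose residual lists cannot be coloured is a whole connected
component. -/
theorem Bad.ball_closed {Δ J : ℕ} (hΔ : 3 ≤ Δ) (hJ : Fintype.card V < 2 ^ J) {v : V}
    {L : V → Finset α} (hbad : Bad G (ball G (3 * Δ * J) v) L) (hdeg : ∀ x, G.degree x ≤ Δ)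
    (hL : ∀ x ∈ ball G (3 * Δ * J) v,
      Δ + degIn G (ball G (3 * Δ * J) v) x ≤ #(L x) + G.degree x) :
    ∀ x ∈ ball G (3 * Δ * J) v, ∀ y, G.Adj x y → y ∈ ball G (3 * Δ * J) v := by
  by_contra! hcon
  obtain ⟨x₀, hx₀, y₀, hxy₀, hy₀⟩ := hcon
  -- bad lists are exactly as long as the degrees, which forces all degrees to be `Δ`
  have hreg : ∀ x ∈ ball G (3 * Δ * J) v, G.degree x = Δ := by
    intro x hx
    have h1 := hbad.card_eq (linked_ball _ v) hx
    have h2 := hL x hx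
    have h3 := hdeg x
    omega
  have hopen : ∀ j ≤ 3 * Δ * J, ∃ x ∈ ball G j v, ∃ y ∉ ball G j v, G.Adj x y := by
    intro j hj
    have h0 : y₀ ∉ ball G j v := fun h => hy₀ (ball_mono hj v h)
    have h1 : Within G (3 * Δ * J + 1) v y₀ := within_succ'.2 (.inr ⟨x₀, mem_ball.1 hx₀, hxy₀⟩)
    obtain ⟨a, ha, b, hb, -, -, h⟩ := h1.exists_exit (A := (ball G j v : Set V))
      (mem_coe.2 (mem_ball.2 (Within.refl _ _ _))) h0
    exact ⟨a, ha, b, hb, h⟩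
  have hgrow : ∀ j ≤ 3 * Δ * J, (3 * Δ + 1) ^ j ≤ (3 * Δ) ^ j * #(ball G j v) := by
    intro j hj
    induction j with
    | zero => simpa using ball_nonempty 0 v
    | succ j ih =>
      obtain ⟨L', hL', -⟩ := hbad.exists_subset (linked_ball _ v)
        (ball_mono (G := G) (show j ≤ 3 * Δ * J by omega) v) (ball_nonempty j v)
      have h1 := card_ball_growth hΔ hL' hdeg
        (fun x hx => hreg x (ball_mono (show j ≤ 3 * Δ * J by omega) v hx)) (hopen j (by omega))
      calc (3 * Δ + 1) ^ (j + 1) = (3 * Δ + 1) * (3 * Δ + 1) ^ j := by ring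
        _ ≤ (3 * Δ + 1) * ((3 * Δ) ^ j * #(ball G j v)) := Nat.mul_le_mul le_rfl (ih (by omega))
        _ = (3 * Δ) ^ j * ((3 * Δ + 1) * #(ball G j v)) := by ring
        _ ≤ (3 * Δ) ^ j * (3 * Δ * #(ball G (j + 1) v)) := Nat.mul_le_mul le_rfl h1
        _ = _ := by ring
  have h1 := hgrow _ le_rfl
  have h2 : 2 ^ J * (3 * Δ) ^ (3 * Δ * J) ≤ (3 * Δ + 1) ^ (3 * Δ * J) := by
    have := Nat.pow_le_pow_left (two_mul_pow_le (3 * Δ) (by omega)) J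
    rwa [mul_pow, ← pow_mul, ← pow_mul] at this
  have h3 : 2 ^ J ≤ #(ball G (3 * Δ * J) v) := by
    refine Nat.le_of_mul_le_mul_left (c := (3 * Δ) ^ (3 * Δ * J)) ?_ (by positivity)
    linarith
  have h4 := card_le_univ (ball G (3 * Δ * J) v)
  omega

end Expansion

/-! ### Functions computable in the LOCAL model -/

/-- What a node can learn: initially its identifier and its list, and in each round its own former
view and those of its neighbours. The order of the list in `node` carries no information. -/
inductive View (α : Type u) : Type u
  | leaf (ident : ℕ) (list : Finset α) : View α
  | node (own : View α) (nbrs : List (View α)) : View α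

/-- A graph whose vertices carry identifiers and lists of colours. -/
structure Network (α : Type u) : Type (max u (v + 1)) where
  V : Type v
  [fin : Fintype V]
  G : SimpleGraph V
  [dec : DecidableRel G.Adj]
  ident : V → ℕ
  lists : V → Finset α

attribute [instance] Network.fin Network.dec

section Locality

variable {α : Type u} {X Y Z : Type*}

/-- The view of each node after a number of rounds in which all nodes tell their views to their
neighbours. -/
noncomputable def Network.view (N : Network.{u, v} α) : ℕ → N.V → View α
  | 0, v => .leaf (N.ident v) (N.lists v)
  | t + 1, v => .node (N.view t v) ((N.G.neighborFinset v).val.map (N.view t)).toList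

/-- The values `f N v` are determined by the views after `T` rounds, by a rule that is the same for
all networks. Here `n` and `Δ` do not belong to the view: they are parameters on which both `f`
and `T` may depend. -/
def IsLocal (T : ℕ) (f : ∀ N : Network.{u, v} α, N.V → X) : Prop :=
  ∃ φ : View α → X, ∀ N v, f N v = φ (N.view T v)

variable {T T' k : ℕ} {f : ∀ N : Network.{u, v} α, N.V → X} {g : ∀ N : Network.{u, v} α, N.V → Y}

lemma isLocal_ident : IsLocal 0 (fun N : Network.{u, v} α => N.ident) :=
  ⟨fun | .leaf i _ => i | .node _ _ => 0, fun _ _ => rfl⟩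

lemma isLocal_lists : IsLocal 0 (fun N : Network.{u, v} α => N.lists) :=
  ⟨fun | .leaf _ l => l | .node _ _ => ∅, fun _ _ => rfl⟩

lemma isLocal_const (x : X) : IsLocal 0 (fun (N : Network.{u, v} α) (_ : N.V) => x) :=
  ⟨fun _ => x, fun _ _ => rfl⟩

lemma IsLocal.comp (hf : IsLocal T f) (F : X → Y) : IsLocal T (fun N v => F (f N v)) := by
  obtain ⟨φ, hφ⟩ := hf
  exact ⟨F ∘ φ, fun N v => by simp [hφ]⟩

lemma IsLocal.mono (hf : IsLocal T f) (hT : T ≤ T') : IsLocal T' f := by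
  induction hT with
  | refl => exact hf
  | step _ ih =>
    obtain ⟨φ, hφ⟩ := ih
    exact ⟨fun | .leaf i l => φ (.leaf i l) | .node w _ => φ w, fun N v => hφ N v⟩

lemma IsLocal.prod (hf : IsLocal T f) (hg : IsLocal T g) :
    IsLocal T (fun N v => (f N v, g N v)) := by
  obtain ⟨φ, hφ⟩ := hf
  obtain ⟨ψ, hψ⟩ := hg
  exact ⟨fun w => (φ w, ψ w), fun N v => by simp only [hφ, hψ]⟩

lemma isLocal_pi {ι : Type*} {f : ι → ∀ N : Network.{u, v} α, N.V → X}
    (hf : ∀ i, IsLocal T (f i)) : IsLocal T (fun N v i => f i N v) := by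
  choose φ hφ using hf
  exact ⟨fun w i => φ i w, fun N v => funext fun i => hφ i N v⟩

/-- One more round reveals the values at the neighbours. -/
lemma IsLocal.nbrs (hf : IsLocal T f) :
    IsLocal (T + 1) (fun N v => f N '' N.G.neighborSet v) := by
  obtain ⟨φ, hφ⟩ := hf
  refine ⟨fun | .leaf _ _ => ∅ | .node _ l => {x | ∃ w ∈ l, φ w = x}, fun N v => ?_⟩
  ext x
  simp [Network.view, hφ]

/-- Any iteration in which a node updates its value using the old values of its neighbours takes
one round per step. -/
lemma IsLocal.iterate {f : ℕ → ∀ N : Network.{u, v} α, N.V → X} (h0 : IsLocal T (f 0))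
    (step : ℕ → X → Set X → X)
    (hstep : ∀ k N v, f (k + 1) N v = step k (f k N v) (f k N '' N.G.neighborSet v)) (k : ℕ) :
    IsLocal (T + k) (f k) := by
  induction k with
  | zero => exact h0
  | succ k ih =>
    obtain ⟨φ, hφ⟩ := ((ih.mono (Nat.le_succ _)).prod ih.nbrs).comp (fun p => step k p.1 p.2)
    exact ⟨φ, fun N v => (hstep k N v).trans (hφ N v)⟩

/-- In `k` more rounds a node learns the values in its ball of radius `k`. -/
lemma IsLocal.gather (hf : IsLocal T f) (k : ℕ) :
    IsLocal (T + k) (fun N v => f N '' {w | Within N.G k v w}) := by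
  refine IsLocal.iterate (f := fun k N v => f N '' {w | Within N.G k v w})
    (by convert hf.comp (fun x => ({x} : Set X)) using 3; simp)
    (fun _ A B => A ∪ ⋃₀ B) (fun k N v => ?_) k
  ext x
  simp only [Set.mem_image, Set.mem_ofPred_eq, within_succ, Set.mem_union, Set.mem_sUnion,
    SimpleGraph.mem_neighborSet, exists_exists_and_eq_and]
  constructor
  · rintro ⟨w, hw | ⟨y, hy, hw⟩, rfl⟩
    · exact .inl ⟨w, hw, rfl⟩
    · exact .inr ⟨y, hy, w, hw, rfl⟩
  · rintro (⟨w, hw, rfl⟩ | ⟨y, hy, w, hw, rfl⟩)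
    · exact ⟨w, .inl hw, rfl⟩
    · exact ⟨w, .inr ⟨y, hy, hw⟩, rfl⟩

/-- The algorithm in which all nodes exchange their views for `T n Δ` rounds, and then apply the
decision function `φ n Δ`. -/
noncomputable def viewAlgorithm {O : Type u} (T : ℕ → ℕ → ℕ) (φ : ℕ → ℕ → View α → O) :
    LocalAlgorithm (ℕ × Finset α) O where
  State := ℕ × ℕ × ℕ × View α
  Msg := View α
  start n i p := (n, p.1, 0, .leaf i p.2)
  send s := s.2.2.2
  receive s M := (s.1, s.2.1, s.2.2.1 + 1, .node s.2.2.2 M.toList)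
  output s := if s.2.2.1 = T s.1 s.2.1 then some (φ s.1 s.2.1 s.2.2.2) else none

lemma viewAlgorithm_state {O : Type u} (T : ℕ → ℕ → ℕ) (φ : ℕ → ℕ → View α → O)
    (N : Network.{u, v} α) (Δ t : ℕ) (v : N.V) :
    (viewAlgorithm T φ).state N.G N.ident (fun w => (Δ, N.lists w)) t v =
      (Fintype.card N.V, Δ, t, N.view t v) := by
  induction t generalizing v with
  | zero => rfl
  | succ t ih =>
    rw [LocalAlgorithm.state, funext ih]
    rfl

/-- Local functions are computed by algorithms in the LOCAL model. -/
theorem exists_localAlgorithm {O : Type u} (T : ℕ → ℕ → ℕ)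
    (f : ℕ → ℕ → ∀ N : Network.{u, v} α, N.V → O) (hf : ∀ n Δ, IsLocal (T n Δ) (f n Δ)) :
    ∃ A : LocalAlgorithm (ℕ × Finset α) O, ∀ (N : Network.{u, v} α) (Δ : ℕ),
      A.OutputsWithin N.G N.ident (fun w => (Δ, N.lists w)) (T (Fintype.card N.V) Δ)
        (f (Fintype.card N.V) Δ N) := by
  choose φ hφ using hf
  refine ⟨viewAlgorithm T φ, fun N Δ v => ⟨_, le_rfl, ?_, fun s hs => ?_⟩⟩
  · rw [viewAlgorithm_state]
    simp [viewAlgorithm, hφ]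
  · rw [viewAlgorithm_state]
    simp [viewAlgorithm, hs.ne]

end Locality

/-! ### Canonical choices -/

section Pick

variable {X : Type*}

open Classical in
/-- A canonical element of a set, if there is one: nodes that know the same set pick the same
element. -/
noncomputable def pick (A : Set X) : Option X := if h : A.Nonempty then some h.some else none

lemma mem_of_pick_eq_some {A : Set X} {x : X} (h : pick A = some x) : x ∈ A := by
  unfold pick at h
  split_ifs at h with hA
  exact Option.some.inj h ▸ hA.some_mem

lemma eq_empty_of_pick_eq_none {A : Set X} (h : pick A = none) : A = ∅ := by
  unfold pick at h
  split_ifs at h with hA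
  exact Set.not_nonempty_iff_eq_empty.1 hA

lemma exists_pick_eq_some {A : Set X} (h : A.Nonempty) : ∃ x ∈ A, pick A = some x :=
  ⟨h.some, h.some_mem, dif_pos h⟩

@[simp] lemma pick_singleton (x : X) : pick {x} = some x := by
  obtain ⟨y, rfl, h⟩ := exists_pick_eq_some (Set.singleton_nonempty x)
  exact h

end Pick

/-! ### Greedy colouring along a schedule -/

section Greedy

variable {V : Type v} {X : Type*} {G : SimpleGraph V} {s : V → ℕ} {L : V → Finset X}

/-- Greedy list-colouring along a schedule `s`: in round `k` each vertex `v` with `s v = k` picks a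
colour of its list that none of its neighbours has. -/
noncomputable def greedy (G : SimpleGraph V) (s : V → ℕ) (L : V → Finset X) : ℕ → V → Option X
  | 0, _ => none
  | k + 1, v => if s v = k then pick {x | x ∈ L v ∧ some x ∉ greedy G s L k '' G.neighborSet v}
      else greedy G s L k v

lemma greedy_eq_none {k : ℕ} {v : V} (h : k ≤ s v) : greedy G s L k v = none := by
  induction k with
  | zero => rfl
  | succ k ih =>
    rw [greedy, if_neg (by omega)]
    exact ih (by omega)

lemma greedy_eq_of_lt {k : ℕ} {v : V} (h : s v < k) :
    greedy G s L k v = greedy G s L (s v + 1) v := by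
  induction k with
  | zero => omega
  | succ k ih =>
    rcases (Nat.lt_succ_iff_lt_or_eq.1 h) with h | h
    · rw [greedy, if_neg h.ne, ih h]
    · rw [h]

lemma greedy_eq_some {k : ℕ} {v : V} {x : X} (h : greedy G s L k v = some x) :
    s v < k ∧ x ∈ L v ∧ ∀ w, G.Adj v w → s w < s v → greedy G s L k w ≠ some x := by
  have hk : s v < k := by
    by_contra! hk
    rw [greedy_eq_none hk] at h
    cases h
  rw [greedy_eq_of_lt hk, greedy, if_pos rfl] at h
  obtain ⟨hx, hw⟩ := mem_of_pick_eq_some h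
  refine ⟨hk, hx, fun w hvw hlt he => hw ⟨w, hvw, ?_⟩⟩
  rw [← he, greedy_eq_of_lt hlt, greedy_eq_of_lt (hlt.trans hk)]

lemma greedy_ne {k : ℕ} {v w : V} (hvw : G.Adj v w) (h : s v = s w → Disjoint (L v) (L w)) {x : X}
    (hv : greedy G s L k v = some x) : greedy G s L k w ≠ some x := by
  intro hw
  rcases lt_trichotomy (s v) (s w) with hlt | heq | hlt
  · exact (greedy_eq_some hw).2.2 v hvw.symm hlt hv
  · exact disjoint_left.1 (h heq) (greedy_eq_some hv).2.1 (greedy_eq_some hw).2.1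
  · exact (greedy_eq_some hv).2.2 w hvw hlt hw

lemma exists_greedy_eq_some [Fintype V] [DecidableRel G.Adj] {k : ℕ} {v : V} (hk : s v < k)
    (h : #{w ∈ G.neighborFinset v | s w < s v} < #(L v)) : ∃ x, greedy G s L k v = some x := by
  classical
  rw [greedy_eq_of_lt hk, greedy, if_pos rfl]
  obtain ⟨x, -, hx⟩ : ∃ x ∈ {x | x ∈ L v ∧ some x ∉ greedy G s L (s v) '' G.neighborSet v}, _ := by
    apply exists_pick_eq_some
    obtain ⟨x, hx, hx'⟩ : ∃ x ∈ (L v).map Function.Embedding.some, x ∉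
        {w ∈ G.neighborFinset v | s w < s v}.image (greedy G s L (s v)) := by
      apply exists_mem_notMem_of_card_lt_card
      rw [card_map]
      exact card_image_le.trans_lt h
    obtain ⟨x, hxL, rfl⟩ := mem_map.1 hx
    refine ⟨x, hxL, ?_⟩
    rintro ⟨w, hw, hwx⟩
    refine hx' (mem_image.2 ⟨w, mem_filter.2 ⟨by simpa using hw, ?_⟩, hwx⟩)
    by_contra! hle
    rw [greedy_eq_none hle] at hwx
    cases hwx
  exact ⟨x, hx⟩

lemma IsLocal.greedy {α : Type u} {T : ℕ} {s : ∀ N : Network.{u, v} α, N.V → ℕ}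
    {L : ∀ N : Network.{u, v} α, N.V → Finset X} (hs : IsLocal T s) (hL : IsLocal T L) (k : ℕ) :
    IsLocal (T + k) (fun N => greedy N.G (s N) (L N) k) := by
  classical
  have := IsLocal.iterate
    (f := fun k N v => (s N v, L N v, LocalBrooks.greedy N.G (s N) (L N) k v))
    (hs.prod (hL.prod ((isLocal_const none).mono (Nat.zero_le _))))
    (fun k p A => (p.1, p.2.1, if p.1 = k then pick {x | x ∈ p.2.1 ∧
      some x ∉ (fun q : ℕ × Finset X × Option X => q.2.2) '' A} else p.2.2))
    (fun k N v => by
      simp only [LocalBrooks.greedy, Set.image_image]) k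
  exact this.comp fun p => p.2.2

end Greedy

/-! ### Colouring and ruling sets from identifiers -/

section Identifiers

variable {V : Type v} {G : SimpleGraph V} {ident : V → ℕ} {Δ : ℕ}

lemma div_two_pow_succ (i j : ℕ) : i / 2 ^ (j + 1) = i / 2 ^ j / 2 := by
  rw [Nat.div_div_eq_div_mul, pow_succ]

/-- Colours below `Δ + 1` that distinguish adjacent vertices whose identifiers agree after removal
of the last `j` bits. When two classes are merged, the vertices choose anew, scheduled by the next
bit and then by their old colours. Tagging the colours with the class keeps the classes
independent. -/
noncomputable def identColor (G : SimpleGraph V) (ident : V → ℕ) (Δ : ℕ) : ℕ → V → ℕ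
  | 0, _ => 0
  | j + 1, v => ((greedy G
      (fun v => ident v / 2 ^ j % 2 * (Δ + 1) + identColor G ident Δ j v)
      (fun v => range (Δ + 1) ×ˢ {ident v / 2 ^ (j + 1)}) (2 * (Δ + 1)) v).map Prod.fst).getD 0

lemma identColor_spec [Fintype V] [DecidableRel G.Adj] (hid : ident.Injective)
    (hdeg : ∀ v, G.degree v ≤ Δ) (j : ℕ) :
    (∀ v, identColor G ident Δ j v < Δ + 1) ∧ ∀ v w, G.Adj v w →
      ident v / 2 ^ j = ident w / 2 ^ j → identColor G ident Δ j v ≠ identColor G ident Δ j w := by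
  induction j with
  | zero =>
    refine ⟨fun v => Nat.succ_pos _, fun v w hvw h => ?_⟩
    simp only [pow_zero, Nat.div_one] at h
    exact absurd (hid h) hvw.ne
  | succ j ih =>
    set s : V → ℕ := fun v => ident v / 2 ^ j % 2 * (Δ + 1) + identColor G ident Δ j v with hs
    set L : V → Finset (ℕ × ℕ) := fun v => range (Δ + 1) ×ˢ {ident v / 2 ^ (j + 1)} with hL
    have hsK : ∀ v, s v < 2 * (Δ + 1) := fun v => by
      have h1 := ih.1 v
      have h2 : ident v / 2 ^ j % 2 * (Δ + 1) ≤ 1 * (Δ + 1) :=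
        Nat.mul_le_mul (by omega) le_rfl
      simp only [hs]
      omega
    have hsome : ∀ v, ∃ x, greedy G s L (2 * (Δ + 1)) v = some x := fun v => by
      refine exists_greedy_eq_some (hsK v) ?_
      have h1 : #(L v) = Δ + 1 := by simp [hL]
      rw [h1]
      refine Nat.lt_succ_of_le ((card_le_card (filter_subset _ _)).trans ?_)
      rw [G.card_neighborFinset_eq_degree]
      exact hdeg v
    have hcol : ∀ v x, greedy G s L (2 * (Δ + 1)) v = some x →
        identColor G ident Δ (j + 1) v = x.1 := fun v x h => by
      change ((greedy G s L (2 * (Δ + 1)) v).map Prod.fst).getD 0 = _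
      rw [h]
      rfl
    refine ⟨fun v => ?_, fun v w hvw hclass => ?_⟩
    · obtain ⟨x, hx⟩ := hsome v
      rw [hcol v x hx]
      have := (greedy_eq_some hx).2.1
      simp only [hL, mem_product, mem_range] at this
      exact this.1
    · obtain ⟨x, hx⟩ := hsome v
      obtain ⟨y, hy⟩ := hsome w
      rw [hcol v x hx, hcol w y hy]
      intro hxy
      have hx2 := (greedy_eq_some hx).2.1
      have hy2 := (greedy_eq_some hy).2.1
      simp only [hL, mem_product, mem_singleton] at hx2 hy2
      have hxy' : x = y := Prod.ext hxy (by rw [hx2.2, hy2.2, hclass])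
      refine greedy_ne hvw (fun hsvw => ?_) hx (hxy' ▸ hy)
      -- two adjacent vertices of the same class are not scheduled at the same time
      exfalso
      have h1 := ih.1 v
      have h2 := ih.1 w
      simp only [hs] at hsvw
      have h3 : ident v / 2 ^ j % 2 = ident w / 2 ^ j % 2 := by
        have h4 := Nat.mod_two_eq_zero_or_one (ident v / 2 ^ j)
        have h5 := Nat.mod_two_eq_zero_or_one (ident w / 2 ^ j)
        rcases h4 with h4 | h4 <;> rcases h5 with h5 | h5 <;> rw [h4, h5] at hsvw ⊢ <;> omega
      rw [h3] at hsvw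
      rw [div_two_pow_succ, div_two_pow_succ] at hclass
      exact ih.2 v w hvw (by omega) (by omega)

lemma isLocal_identColor {α : Type u} (Δ j : ℕ) :
    IsLocal (j * (2 * (Δ + 1))) (fun N : Network.{u, v} α => identColor N.G N.ident Δ j) := by
  induction j with
  | zero => exact (isLocal_const 0).mono (Nat.zero_le _)
  | succ j ih =>
    have hid : IsLocal (j * (2 * (Δ + 1))) (fun N : Network.{u, v} α => N.ident) :=
      isLocal_ident.mono (Nat.zero_le _)
    have := (IsLocal.greedy
      ((hid.prod ih).comp fun p => p.1 / 2 ^ j % 2 * (Δ + 1) + p.2)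
      (hid.comp fun i => range (Δ + 1) ×ˢ {i / 2 ^ (j + 1)}) (2 * (Δ + 1))).comp
      (fun o => (o.map Prod.fst).getD 0)
    rw [Nat.succ_mul]
    exact this

/-- The ruling set after `j` merging steps: among vertices whose identifiers agree after removal
of the last `j + 1` bits, those with bit `j` equal to `1` drop out if they are within distance `a`
of a remaining one with bit `j` equal to `0`. -/
def ruling (G : SimpleGraph V) (ident : V → ℕ) (a : ℕ) : ℕ → V → Prop
  | 0, _ => True
  | j + 1, v => ruling G ident a j v ∧ (ident v / 2 ^ j % 2 = 1 →
      ∀ u, Within G a v u → ruling G ident a j u → ident u / 2 ^ j % 2 = 0 →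
        ident u / 2 ^ (j + 1) ≠ ident v / 2 ^ (j + 1))

lemma eq_of_ruling_of_within (hid : ident.Injective) {a j : ℕ} {v w : V}
    (hv : ruling G ident a j v) (hw : ruling G ident a j w) (h : Within G a v w)
    (hj : ident v / 2 ^ j = ident w / 2 ^ j) : v = w := by
  induction j with
  | zero => exact hid (by simpa using hj)
  | succ j ih =>
    have hj' := hj
    rw [div_two_pow_succ, div_two_pow_succ] at hj'
    rcases Nat.mod_two_eq_zero_or_one (ident v / 2 ^ j) with h1 | h1 <;>
      rcases Nat.mod_two_eq_zero_or_one (ident w / 2 ^ j) with h2 | h2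
    · exact ih hv.1 hw.1 (by omega)
    · exact absurd hj (hw.2 h2 v h.symm hv.1 h1)
    · exact absurd hj.symm (hv.2 h1 w h hw.1 h2)
    · exact ih hv.1 hw.1 (by omega)

lemma exists_ruling_within (a j : ℕ) (v : V) :
    ∃ u, ruling G ident a j u ∧ Within G (j * a) v u := by
  induction j with
  | zero => exact ⟨v, trivial, Within.refl _ _ _⟩
  | succ j ih =>
    obtain ⟨u, hu, hvu⟩ := ih
    rw [Nat.succ_mul]
    by_cases h : ruling G ident a (j + 1) u
    · exact ⟨u, h, hvu.mono (by omega)⟩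
    · simp only [ruling, hu, true_and] at h
      push Not at h
      obtain ⟨-, w, huw, hw, hw0, -⟩ := h
      exact ⟨w, ⟨hw, fun h => by omega⟩, hvu.trans huw⟩

lemma isLocal_ruling {α : Type u} (a j : ℕ) :
    IsLocal (j * a) (fun N : Network.{u, v} α => ruling N.G N.ident a j) := by
  induction j with
  | zero => exact (isLocal_const True).mono (Nat.zero_le _)
  | succ j ih =>
    have hid : IsLocal (j * a) (fun N : Network.{u, v} α => N.ident) :=
      isLocal_ident.mono (Nat.zero_le _)
    have := (((hid.prod ih).mono (Nat.le_add_right _ a)).prod ((hid.prod ih).gather a)).comp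
      (fun p => p.1.2 ∧ (p.1.1 / 2 ^ j % 2 = 1 → ∀ q ∈ p.2, q.2 → q.1 / 2 ^ j % 2 = 0 →
        q.1 / 2 ^ (j + 1) ≠ p.1.1 / 2 ^ (j + 1)))
    rw [Nat.succ_mul]
    convert this using 3
    simp [ruling]

end Identifiers

/-! ### Distances to a set of roots -/

section Levels

variable {V : Type v} {G : SimpleGraph V} {S : V → Prop} {D : ℕ} {v : V}

/-- The distance to the set `S`, truncated at `D`. -/
noncomputable def level (G : SimpleGraph V) (S : V → Prop) (D : ℕ) (v : V) : ℕ :=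
  sInf {k | D ≤ k ∨ ∃ u, S u ∧ Within G k v u}

lemma level_le : level G S D v ≤ D := Nat.sInf_le (.inl le_rfl)

lemma level_le_of_within {k : ℕ} {u : V} (hu : S u) (h : Within G k v u) : level G S D v ≤ k :=
  Nat.sInf_le (.inr ⟨u, hu, h⟩)

lemma exists_within_level (hcover : ∃ u, S u ∧ Within G D v u) :
    ∃ u, S u ∧ Within G (level G S D v) v u := by
  have h : level G S D v ∈ {k | D ≤ k ∨ ∃ u, S u ∧ Within G k v u} :=
    Nat.sInf_mem ⟨D, .inl le_rfl⟩
  rcases h with h | h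
  · obtain ⟨u, hu, huv⟩ := hcover
    exact ⟨u, hu, huv.mono h⟩
  · exact h

lemma exists_adj_level_lt (hcover : ∃ u, S u ∧ Within G D v u) (hv : ¬ S v) :
    ∃ w, G.Adj v w ∧ level G S D w < level G S D v := by
  obtain ⟨u, hu, huv⟩ := exists_within_level hcover
  rcases hk : level G S D v with _ | k
  · rw [hk, within_zero] at huv
    exact absurd (huv ▸ hu) hv
  · rw [hk, within_succ] at huv
    rcases huv with huv | ⟨w, hvw, hwu⟩
    · have := level_le_of_within (D := D) hu huv
      omega
    · exact ⟨w, hvw, Nat.lt_succ_of_le (level_le_of_within hu hwu)⟩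

lemma IsLocal.exists_within {α : Type u} {T : ℕ} {S : ∀ N : Network.{u, v} α, N.V → Prop}
    (hS : IsLocal T S) (k : ℕ) : IsLocal (T + k) (fun N v => ∃ u, S N u ∧ Within N.G k v u) := by
  convert (hS.gather k).comp (fun A => True ∈ A) using 3
  simp [and_comm]

lemma IsLocal.level {α : Type u} {T : ℕ} {S : ∀ N : Network.{u, v} α, N.V → Prop}
    (hS : IsLocal T S) (D : ℕ) : IsLocal (T + D) (fun N => level N.G (S N) D) := by
  have : ∀ k, IsLocal (T + D)
      (fun (N : Network.{u, v} α) v => D ≤ k ∨ ∃ u, S N u ∧ Within N.G k v u) := fun k => by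
    rcases le_total D k with h | h
    · simpa only [h, true_or] using (isLocal_const True).mono (Nat.zero_le _)
    · exact ((hS.exists_within k).comp (fun p => D ≤ k ∨ p)).mono (by omega)
  exact (isLocal_pi this).comp fun p => sInf {k | p k}

end Levels

/-! ### The outputs of the nodes -/

section Algorithm

variable {V : Type v} {α : Type u} (G : SimpleGraph V) (ident : V → ℕ) (L : V → Finset α)
  (Δ J : ℕ)

/-- The radius of the balls around the roots, in which the colouring is completed last. -/
def radius (Δ J : ℕ) : ℕ := 3 * Δ * J

/-- The roots are at distance greater than `separation Δ J`, so that the balls around them are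
disjoint and no edge joins two of them. -/
def separation (Δ J : ℕ) : ℕ := 2 * radius Δ J + 1

/-- Every vertex is within this distance of a root. -/
def covering (Δ J : ℕ) : ℕ := J * separation Δ J

/-- The roots of the clusters. -/
def IsRoot : V → Prop := ruling G ident (separation Δ J) J

/-- The vertex lies in the ball around some root. -/
def InBall (v : V) : Prop := ∃ u, IsRoot G ident Δ J u ∧ Within G (radius Δ J) v u

open Classical in
/-- Outside of the balls the vertices are coloured from far to near, and in the order given by a
proper colouring with `Δ + 1` colours where the distances agree; the vertices in the balls are
scheduled too late to be coloured. -/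
noncomputable def schedule (v : V) : ℕ :=
  if InBall G ident Δ J v then (covering Δ J + 1) * (Δ + 1)
  else (covering Δ J - level G (IsRoot G ident Δ J) (covering Δ J) v) * (Δ + 1) +
    identColor G ident Δ J v

/-- The colouring of the vertices outside of the balls. -/
noncomputable def outer : V → Option α :=
  greedy G (schedule G ident Δ J) L ((covering Δ J + 1) * (Δ + 1))

open Classical in
/-- The colours of the list that are not used by coloured neighbours. -/
noncomputable def residual (v : V) : Finset α :=
  {x ∈ L v | some x ∉ outer G ident L Δ J '' G.neighborSet v}

/-- The part of the list-colouring problem in the balls that a vertex knows: its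
identifier, its residual list, and the identifiers of its neighbours. -/
noncomputable def fact (v : V) : ℕ × Finset α × Set ℕ :=
  (ident v, residual G ident L Δ J v, ident '' G.neighborSet v)

/-- The colouring `c` of identifiers solves the list-colouring problem described by the set `D` of
facts. -/
def Solves (D : Set (ℕ × Finset α × Set ℕ)) (c : ℕ → α) : Prop :=
  ∀ p ∈ D, c p.1 ∈ p.2.1 ∧ ∀ q ∈ D, q.1 ∈ p.2.2 → c p.1 ≠ c q.1

/-- The colouring that a root chooses for its ball, if there is one. -/
noncomputable def plan (v : V) : Option (ℕ → α) :=
  pick {c | Solves (fact G ident L Δ J '' {w | Within G (radius Δ J) v w}) c}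

/-- The plans of the roots in the ball around a vertex. -/
def plans (v : V) : Set (Option (ℕ → α)) :=
  {p | ∃ u, IsRoot G ident Δ J u ∧ Within G (radius Δ J) v u ∧ plan G ident L Δ J u = p}

/-- The output of a node with colour `o` from the first phase, identifier `i`, and known plans
`P`. -/
noncomputable def decision (o : Option α) (i : ℕ) (P : Set (Option (ℕ → α))) : NodeOutput α :=
  match o, pick P with
  | some x, _ => .color x
  | none, some (some c) => .color (c i)
  | none, _ => .noColoring

/-- The outputs of the nodes. -/
noncomputable def result (v : V) : NodeOutput α :=
  decision (outer G ident L Δ J v) (ident v) (plans G ident L Δ J v)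

end Algorithm

/-! ### Locality of the outputs -/

section Rounds

variable {α : Type u} (Δ J : ℕ)

/-- The number of rounds after which the nodes know the schedule. -/
def scheduleRounds (Δ J : ℕ) : ℕ :=
  J * (2 * (Δ + 1)) + J * separation Δ J + covering Δ J + radius Δ J

/-- The number of rounds after which the nodes know their outputs. -/
def rounds (Δ J : ℕ) : ℕ :=
  scheduleRounds Δ J + (covering Δ J + 1) * (Δ + 1) + 1 + radius Δ J + radius Δ J

lemma isLocal_schedule :
    IsLocal (scheduleRounds Δ J) (fun N : Network.{u, v} α => schedule N.G N.ident Δ J) := by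
  classical
  have hS : IsLocal (J * separation Δ J)
      (fun N : Network.{u, v} α => IsRoot N.G N.ident Δ J) := isLocal_ruling _ _
  have h1 := (isLocal_identColor (α := α) Δ J).mono
    (show _ ≤ scheduleRounds Δ J by unfold scheduleRounds; omega)
  have h2 := (hS.level (covering Δ J)).mono
    (show _ ≤ scheduleRounds Δ J by unfold scheduleRounds; omega)
  have h3 := (hS.exists_within (radius Δ J)).mono
    (show _ ≤ scheduleRounds Δ J by unfold scheduleRounds; omega)
  exact ((h3.prod (h2.prod h1)).comp fun p =>
    if p.1 then (covering Δ J + 1) * (Δ + 1) else (covering Δ J - p.2.1) * (Δ + 1) + p.2.2)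

lemma isLocal_result :
    IsLocal (rounds Δ J) (fun N : Network.{u, v} α => result N.G N.ident N.lists Δ J) := by
  classical
  have hs := isLocal_schedule (α := α) Δ J
  have ho : IsLocal (scheduleRounds Δ J + (covering Δ J + 1) * (Δ + 1))
      (fun N : Network.{u, v} α => outer N.G N.ident N.lists Δ J) :=
    hs.greedy (isLocal_lists.mono (Nat.zero_le _)) _
  have hr : IsLocal (scheduleRounds Δ J + (covering Δ J + 1) * (Δ + 1) + 1)
      (fun N : Network.{u, v} α => residual N.G N.ident N.lists Δ J) :=
    ((isLocal_lists.mono (Nat.zero_le _)).prod ho.nbrs).comp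
      (fun p : Finset α × Set (Option α) => {x ∈ p.1 | some x ∉ p.2})
  have hf : IsLocal (scheduleRounds Δ J + (covering Δ J + 1) * (Δ + 1) + 1)
      (fun N : Network.{u, v} α => fact N.G N.ident N.lists Δ J) :=
    (isLocal_ident.mono (Nat.zero_le _)).prod
      (hr.prod (isLocal_ident.nbrs.mono (Nat.le_add_left _ _)))
  have hp : IsLocal (scheduleRounds Δ J + (covering Δ J + 1) * (Δ + 1) + 1 + radius Δ J)
      (fun N : Network.{u, v} α => plan N.G N.ident N.lists Δ J) :=
    (hf.gather _).comp fun D => pick {c | Solves D c}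
  have hS : IsLocal (scheduleRounds Δ J + (covering Δ J + 1) * (Δ + 1) + 1 + radius Δ J)
      (fun N : Network.{u, v} α => IsRoot N.G N.ident Δ J) :=
    (isLocal_ruling _ _).mono (by unfold scheduleRounds; omega)
  have hP : IsLocal (rounds Δ J)
      (fun N : Network.{u, v} α => plans N.G N.ident N.lists Δ J) := by
    have := ((hS.prod hp).gather (radius Δ J)).comp
      (fun A : Set (Prop × Option (ℕ → α)) => {p | ∃ q ∈ A, q.1 ∧ q.2 = p})
    change IsLocal (rounds Δ J) _ at this
    convert this using 3
    ext p
    simp only [plans, Set.mem_ofPred_eq, Set.mem_image, exists_exists_and_eq_and]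
    exact exists_congr fun u => by tauto
  exact (((ho.mono (by unfold rounds; omega)).prod
    ((isLocal_ident.mono (Nat.zero_le _)).prod hP)).comp fun p => decision p.1 p.2.1 p.2.2)

end Rounds

/-! ### Correctness -/

section Correctness

variable {V : Type v} {α : Type u} [Fintype V] {G : SimpleGraph V} [DecidableRel G.Adj]
  {ident : V → ℕ} {L : V → Finset α} {Δ J : ℕ}

lemma eq_of_isRoot (hid : ident.Injective) (hJ : ∀ v, ident v < 2 ^ J) {u w : V}
    (hu : IsRoot G ident Δ J u) (hw : IsRoot G ident Δ J w)
    (h : Within G (separation Δ J) u w) : u = w :=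
  eq_of_ruling_of_within hid hu hw h
    (by rw [Nat.div_eq_of_lt (hJ u), Nat.div_eq_of_lt (hJ w)])

lemma schedule_of_inBall {v : V} (h : InBall G ident Δ J v) :
    schedule G ident Δ J v = (covering Δ J + 1) * (Δ + 1) := if_pos h

lemma schedule_of_not_inBall {v : V} (h : ¬ InBall G ident Δ J v) : schedule G ident Δ J v =
    (covering Δ J - level G (IsRoot G ident Δ J) (covering Δ J) v) * (Δ + 1) +
      identColor G ident Δ J v := if_neg h

lemma outer_of_inBall {v : V} (h : InBall G ident Δ J v) : outer G ident L Δ J v = none :=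
  greedy_eq_none (schedule_of_inBall h).ge

lemma schedule_lt (hid : ident.Injective) (hdeg : ∀ v, G.degree v ≤ Δ) {v : V}
    (h : ¬ InBall G ident Δ J v) : schedule G ident Δ J v < (covering Δ J + 1) * (Δ + 1) := by
  rw [schedule_of_not_inBall h, Nat.succ_mul]
  have h1 := (identColor_spec (G := G) hid hdeg J).1 v
  have h2 : (covering Δ J - level G (IsRoot G ident Δ J) (covering Δ J) v) * (Δ + 1) ≤
    covering Δ J * (Δ + 1) := Nat.mul_le_mul (Nat.sub_le _ _) le_rfl
  omega

/-- Outside of the balls every vertex gets a colour, as it has a neighbour nearer to the roots,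
which is coloured later or never. -/
lemma exists_outer_eq_some (hid : ident.Injective) (hdeg : ∀ v, G.degree v ≤ Δ)
    (hL : IsListAssignment Δ L) {v : V} (h : ¬ InBall G ident Δ J v) :
    ∃ x, outer G ident L Δ J v = some x := by
  refine exists_greedy_eq_some (schedule_lt hid hdeg h) ?_
  obtain ⟨w, hvw, hlt⟩ := exists_adj_level_lt (D := covering Δ J) (v := v)
    (exists_ruling_within (G := G) (ident := ident) (separation Δ J) J v)
    (fun hv => h ⟨v, hv, Within.refl _ _ _⟩)
  have hs : schedule G ident Δ J v < schedule G ident Δ J w := by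
    by_cases hw : InBall G ident Δ J w
    · rw [schedule_of_inBall hw]
      exact schedule_lt hid hdeg h
    · rw [schedule_of_not_inBall h, schedule_of_not_inBall hw]
      have h1 := (identColor_spec (G := G) hid hdeg J).1 v
      have h2 : level G (IsRoot G ident Δ J) (covering Δ J) v ≤ covering Δ J := level_le
      have h3 : (covering Δ J - level G (IsRoot G ident Δ J) (covering Δ J) v + 1) * (Δ + 1) ≤
          (covering Δ J - level G (IsRoot G ident Δ J) (covering Δ J) w) * (Δ + 1) := by
        refine Nat.mul_le_mul ?_ le_rfl
        change level G (IsRoot G ident Δ J) (covering Δ J) w <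
          level G (IsRoot G ident Δ J) (covering Δ J) v at hlt
        omega
      rw [Nat.succ_mul] at h3
      omega
  refine lt_of_lt_of_le ?_ ((hdeg v).trans (hL v))
  rw [← G.card_neighborFinset_eq_degree]
  refine card_lt_card ⟨filter_subset _ _, fun hsub => ?_⟩
  have := (mem_filter.1 (hsub ((G.mem_neighborFinset v w).2 hvw))).2
  omega

lemma outer_ne (hid : ident.Injective) (hJ : ∀ v, ident v < 2 ^ J)
    (hdeg : ∀ v, G.degree v ≤ Δ) {v w : V} (hvw : G.Adj v w) {x : α}
    (hv : outer G ident L Δ J v = some x) : outer G ident L Δ J w ≠ some x := by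
  intro hw
  have hv' : ¬ InBall G ident Δ J v := fun h => by rw [outer_of_inBall h] at hv; cases hv
  have hw' : ¬ InBall G ident Δ J w := fun h => by rw [outer_of_inBall h] at hw; cases hw
  refine greedy_ne hvw (fun hs => ?_) hv hw
  exfalso
  obtain ⟨h1, h2⟩ := identColor_spec (G := G) hid hdeg J
  rw [schedule_of_not_inBall hv', schedule_of_not_inBall hw'] at hs
  refine h2 v w hvw (by rw [Nat.div_eq_of_lt (hJ v), Nat.div_eq_of_lt (hJ w)]) ?_
  have := congrArg (· % (Δ + 1)) hs
  simpa [Nat.mul_add_mod_of_lt, Nat.add_mod, Nat.mod_eq_of_lt (h1 v), Nat.mod_eq_of_lt (h1 w)]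
    using this

lemma mem_residual {v : V} {x : α} : x ∈ residual G ident L Δ J v ↔
    x ∈ L v ∧ ∀ w, G.Adj v w → outer G ident L Δ J w ≠ some x := by
  classical
  simp [residual]

/-- A vertex in the ball of a root follows the plan of this root. -/
lemma result_of_isRoot (hid : ident.Injective) (hJ : ∀ v, ident v < 2 ^ J) {u v : V}
    (hu : IsRoot G ident Δ J u) (hvu : Within G (radius Δ J) v u) :
    result G ident L Δ J v = match plan G ident L Δ J u with
      | some c => .color (c (ident v))
      | none => .noColoring := by
  have h : plans G ident L Δ J v = {plan G ident L Δ J u} := by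
    refine Set.eq_singleton_iff_unique_mem.2 ⟨⟨u, hu, hvu, rfl⟩, ?_⟩
    rintro _ ⟨w, hw, hvw, rfl⟩
    rw [eq_of_isRoot hid hJ hu hw ((hvu.symm.trans hvw).mono (by unfold separation; omega))]
  rw [result, h, outer_of_inBall ⟨u, hu, hvu⟩]
  unfold decision
  rw [pick_singleton]
  cases plan G ident L Δ J u <;> rfl

lemma result_of_outer {v : V} {x : α} (h : outer G ident L Δ J v = some x) :
    result G ident L Δ J v = .color x := by
  rw [result, h, decision]

lemma plan_spec {u : V} {c : ℕ → α} (h : plan G ident L Δ J u = some c) {v : V}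
    (huv : Within G (radius Δ J) v u) : c (ident v) ∈ residual G ident L Δ J v ∧
      ∀ w, Within G (radius Δ J) w u → G.Adj v w → c (ident v) ≠ c (ident w) := by
  have hc := mem_of_pick_eq_some h
  have := hc _ ⟨v, huv.symm, rfl⟩
  exact ⟨this.1, fun w hw hvw => this.2 _ ⟨w, hw.symm, rfl⟩ ⟨w, hvw, rfl⟩⟩

/-- Whether a vertex has a colour, and which one, comes from one of the two phases. -/
lemma result_cases (hid : ident.Injective) (hJ : ∀ v, ident v < 2 ^ J)
    (hdeg : ∀ v, G.degree v ≤ Δ) (hL : IsListAssignment Δ L) (v : V) :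
    (∃ x, outer G ident L Δ J v = some x ∧ result G ident L Δ J v = .color x) ∨
    ∃ u, IsRoot G ident Δ J u ∧ Within G (radius Δ J) v u ∧
      ((∃ c, plan G ident L Δ J u = some c ∧ result G ident L Δ J v = .color (c (ident v))) ∨
        (plan G ident L Δ J u = none ∧ result G ident L Δ J v = .noColoring)) := by
  by_cases h : InBall G ident Δ J v
  · obtain ⟨u, hu, hvu⟩ := h
    have := result_of_isRoot (L := L) hid hJ hu hvu
    refine .inr ⟨u, hu, hvu, ?_⟩
    rcases hp : plan G ident L Δ J u with _ | c <;> rw [hp] at this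
    · exact .inr ⟨rfl, this⟩
    · exact .inl ⟨c, rfl, this⟩
  · obtain ⟨x, hx⟩ := exists_outer_eq_some hid hdeg hL h
    exact .inl ⟨x, hx, result_of_outer hx⟩

lemma mem_of_result (hid : ident.Injective) (hJ : ∀ v, ident v < 2 ^ J)
    (hdeg : ∀ v, G.degree v ≤ Δ) (hL : IsListAssignment Δ L) {v : V} {x : α}
    (h : result G ident L Δ J v = .color x) : x ∈ L v := by
  rcases result_cases hid hJ hdeg hL v with
    ⟨y, hy, h'⟩ | ⟨u, -, hvu, ⟨c, hc, h'⟩ | ⟨-, h'⟩⟩ <;> rw [h] at h' <;> cases h'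
  · exact (greedy_eq_some hy).2.1
  · exact (mem_residual.1 (plan_spec hc hvu).1).1

lemma ne_of_result (hid : ident.Injective) (hJ : ∀ v, ident v < 2 ^ J)
    (hdeg : ∀ v, G.degree v ≤ Δ) (hL : IsListAssignment Δ L) {v w : V} (hvw : G.Adj v w) {x y : α}
    (hv : result G ident L Δ J v = .color x) (hw : result G ident L Δ J w = .color y) :
    x ≠ y := by
  rcases result_cases hid hJ hdeg hL v with
    ⟨x', hx, h'⟩ | ⟨u, hu, hvu, ⟨c, hc, h'⟩ | ⟨-, h'⟩⟩ <;> rw [hv] at h' <;> cases h' <;>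
  rcases result_cases hid hJ hdeg hL w with
    ⟨y', hy, h'⟩ | ⟨u', hu', hwu, ⟨c', hc', h'⟩ | ⟨-, h'⟩⟩ <;> rw [hw] at h' <;> cases h'
  · rintro rfl
    exact outer_ne hid hJ hdeg hvw hx hy
  · rintro rfl
    exact (mem_residual.1 (plan_spec hc' hwu).1).2 v hvw.symm hx
  · rintro rfl
    exact (mem_residual.1 (plan_spec hc hvu).1).2 w hvw hy
  · have huu' : u = u' := eq_of_isRoot hid hJ hu hu'
      (((hvu.symm.trans (Within.of_adj hvw)).trans hwu).mono (by unfold separation; omega))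
    subst huu'
    obtain rfl : c = c' := Option.some.inj (hc.symm.trans hc')
    exact (plan_spec hc hvu).2 w hwu hvw

/-- If a root finds no colouring for its ball, then this ball is closed under adjacency, and there
is no list-colouring of it at all. -/
lemma plan_eq_none (hid : ident.Injective) (hJ : Fintype.card V < 2 ^ J) (hΔ : 3 ≤ Δ)
    (hdeg : ∀ v, G.degree v ≤ Δ) (hL : IsListAssignment Δ L) {u : V}
    (hu : IsRoot G ident Δ J u) (h : plan G ident L Δ J u = none) :
    (∀ w, G.Reachable u w → Within G (radius Δ J) u w) ∧
      ¬ ∃ f : V → α, ∀ v, Within G (radius Δ J) u v → f v ∈ L v ∧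
        ∀ w, Within G (radius Δ J) u w → G.Adj v w → f v ≠ f w := by
  classical
  have hnone : ∀ v ∈ ball G (radius Δ J) u, outer G ident L Δ J v = none := fun v hv =>
    outer_of_inBall ⟨u, hu, (mem_ball.1 hv).symm⟩
  have hsol : ¬ ∃ f : V → α, ∀ v ∈ ball G (radius Δ J) u, f v ∈ residual G ident L Δ J v ∧
      ∀ w ∈ ball G (radius Δ J) u, G.Adj v w → f v ≠ f w := by
    rintro ⟨f, hf⟩
    have hext : ∀ v, Function.extend ident f (fun _ => f u) (ident v) = f v :=
      fun v => hid.extend_apply _ _ v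
    refine Set.eq_empty_iff_forall_notMem.1 (eq_empty_of_pick_eq_none h)
      (Function.extend ident f (fun _ => f u)) ?_
    rintro _ ⟨v, hv, rfl⟩
    refine ⟨?_, ?_⟩
    · simp only [fact, hext]
      exact (hf v (mem_ball.2 hv)).1
    · rintro _ ⟨w, hw, rfl⟩ hvw
      simp only [fact, hext]
      obtain ⟨w', hvw', hw'⟩ := hvw
      obtain rfl := hid hw'
      exact (hf v (mem_ball.2 hv)).2 _ (mem_ball.2 hw) hvw'
  -- only the neighbours outside of the ball may take colours from a list
  have hlen : ∀ x ∈ ball G (radius Δ J) u, Δ + degIn G (ball G (radius Δ J) u) x ≤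
      #(residual G ident L Δ J x) + G.degree x := by
    intro x hx
    set B := ball G (radius Δ J) u with hB
    have hsub : (L x \ residual G ident L Δ J x).map Function.Embedding.some ⊆
        (G.neighborFinset x \ B).image (outer G ident L Δ J) := by
      intro o ho
      obtain ⟨a, ha, rfl⟩ := mem_map.1 ho
      rw [mem_sdiff, mem_residual] at ha
      obtain ⟨haL, ha⟩ := ha
      push Not at ha
      obtain ⟨w, hxw, hw⟩ := ha haL
      refine mem_image.2 ⟨w, mem_sdiff.2 ⟨by simpa using hxw, fun hwB => ?_⟩, hw⟩
      rw [hnone w hwB] at hw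
      cases hw
    have h1 := (card_le_card hsub).trans card_image_le
    rw [card_map] at h1
    have h2 : degIn G B x = #(G.neighborFinset x ∩ B) := by
      rw [degIn]
      congr 1
      ext y
      simp [and_comm]
    have h3 := card_inter_add_card_sdiff (G.neighborFinset x) B
    rw [G.card_neighborFinset_eq_degree] at h3
    have h4 := le_card_sdiff (residual G ident L Δ J x) (L x)
    have h5 := hL x
    omega
  have hbad : Bad G (ball G (radius Δ J) u) (residual G ident L Δ J) :=
    ⟨fun x hx => by
      have h1 := hlen x hx
      have h2 := hdeg x
      omega, hsol⟩
  have hclosed : ∀ x ∈ ball G (radius Δ J) u, ∀ y, G.Adj x y → y ∈ ball G (radius Δ J) u :=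
    hbad.ball_closed hΔ hJ hdeg hlen
  refine ⟨?_, ?_⟩
  · rintro w ⟨p⟩
    -- a walk from `u` out of the ball would have to use an edge leaving it
    by_contra hw
    have hpw : Within G p.length u w := ⟨p, le_rfl⟩
    obtain ⟨a, ha, b, hb, -, -, hab⟩ := hpw.exists_exit
      (A := {w | Within G (radius Δ J) u w}) (Within.refl _ _ _) hw
    exact hb (mem_ball.1 (hclosed a (mem_ball.2 ha) b hab))
  · rintro ⟨f, hf⟩
    refine hsol ⟨f, fun v hv => ⟨mem_residual.2 ⟨(hf v (mem_ball.1 hv)).1, fun w hvw => ?_⟩,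
      fun w hw => (hf v (mem_ball.1 hv)).2 w (mem_ball.1 hw)⟩⟩
    rw [hnone w (hclosed v hv w hvw)]
    simp

/-- The outputs are correct on each connected component. -/
theorem result_component (hid : ident.Injective) (hJ : Fintype.card V < 2 ^ J)
    (hJ' : ∀ v, ident v < 2 ^ J) (hΔ : 3 ≤ Δ) (hdeg : ∀ v, G.degree v ≤ Δ)
    (hL : IsListAssignment Δ L) (K : G.ConnectedComponent) :
    FindsListColoring K.toSimpleGraph (fun w => L w) (fun w => result G ident L Δ J w) ∨
      (¬ IsListColorable K.toSimpleGraph (fun w => L w) ∧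
        ∀ w ∈ K, result G ident L Δ J w = .noColoring) := by
  classical
  by_cases hall : ∀ v ∈ K, ∃ x, result G ident L Δ J v = .color x
  · left
    choose c hc using hall
    refine ⟨fun v => c v v.2, ⟨fun v w hvw => ?_, fun v => ?_⟩, fun v => hc v v.2⟩
    · exact ne_of_result hid hJ' hdeg hL (K.toSimpleGraph_hom.map_adj hvw) (hc v v.2) (hc w w.2)
    · exact mem_of_result hid hJ' hdeg hL (hc v v.2)
  · right
    push Not at hall
    obtain ⟨v, hv, hvc⟩ := hall
    obtain ⟨u, hu, hvu, hplan⟩ : ∃ u, IsRoot G ident Δ J u ∧ Within G (radius Δ J) v u ∧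
        plan G ident L Δ J u = none := by
      rcases result_cases hid hJ' hdeg hL v with
        ⟨x, -, h⟩ | ⟨u, hu, hvu, ⟨c, -, h⟩ | ⟨h, -⟩⟩
      · exact absurd h (hvc x)
      · exact absurd h (hvc _)
      · exact ⟨u, hu, hvu, h⟩
    obtain ⟨hreach, hcol⟩ := plan_eq_none hid hJ hΔ hdeg hL hu hplan
    have hmem : ∀ w, w ∈ K ↔ Within G (radius Δ J) u w := by
      intro w
      have hvK : G.connectedComponentMk v = K := hv
      change G.connectedComponentMk w = K ↔ _
      rw [← hvK, SimpleGraph.ConnectedComponent.eq]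
      exact ⟨fun h => hreach w (hvu.symm.reachable.trans h.symm),
        fun h => h.symm.reachable.trans hvu.symm.reachable⟩
    refine ⟨?_, fun w hw => ?_⟩
    · rintro ⟨c, hadj, hlist⟩
      refine hcol ⟨fun w => if hw : w ∈ K then c ⟨w, hw⟩ else c ⟨v, hv⟩, fun w hw => ?_⟩
      rw [← hmem] at hw
      simp only [dif_pos hw]
      refine ⟨hlist ⟨w, hw⟩, fun z hz hwz => ?_⟩
      rw [← hmem] at hz
      simp only [dif_pos hz]
      exact hadj ⟨w, hw⟩ ⟨z, hz⟩ hwz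
    · have := result_of_isRoot (L := L) hid hJ' hu ((hmem w).1 hw).symm
      rwa [hplan] at this

/-- Outputs that are correct on the connected components are correct globally. -/
lemma findsListColoring_or (out : V → NodeOutput α)
    (h : ∀ K : G.ConnectedComponent,
      FindsListColoring K.toSimpleGraph (fun w => L w) (fun w => out w) ∨
        (¬ IsListColorable K.toSimpleGraph (fun w => L w) ∧ ∀ w ∈ K, out w = .noColoring)) :
    FindsListColoring G L out ∨ (¬ IsListColorable G L ∧ ∃ w, out w = .noColoring) := by
  by_cases hall : ∀ K : G.ConnectedComponent,
      FindsListColoring K.toSimpleGraph (fun w => L w) (fun w => out w)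
  · left
    choose c hc hout using hall
    have hmem : ∀ v, v ∈ G.connectedComponentMk v := fun v => rfl
    refine ⟨fun v => c (G.connectedComponentMk v) ⟨v, hmem v⟩, ⟨fun v w hvw => ?_, fun v => ?_⟩,
      fun v => hout _ ⟨v, hmem v⟩⟩
    · have hw : w ∈ G.connectedComponentMk v :=
        SimpleGraph.ConnectedComponent.eq.2 hvw.symm.reachable
      -- both are read off from the output of `w`
      have key : c (G.connectedComponentMk w) ⟨w, hmem w⟩ =
          c (G.connectedComponentMk v) ⟨w, hw⟩ := by
        have h1 := hout (G.connectedComponentMk w) ⟨w, hmem w⟩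
        have h2 := hout (G.connectedComponentMk v) ⟨w, hw⟩
        exact NodeOutput.color.inj (h1.symm.trans h2)
      change c _ ⟨v, hmem v⟩ ≠ c _ ⟨w, hmem w⟩
      rw [key]
      exact (hc (G.connectedComponentMk v)).1 ⟨v, hmem v⟩ ⟨w, hw⟩ hvw
    · exact (hc _).2 ⟨v, hmem v⟩
  · right
    push Not at hall
    obtain ⟨K, hK⟩ := hall
    obtain ⟨hcol, hout⟩ := (h K).resolve_left hK
    obtain ⟨w, hw⟩ := K.nonempty_supp
    refine ⟨?_, w, hout w hw⟩
    rintro ⟨c, hadj, hlist⟩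
    exact hcol ⟨fun v => c v, fun v w hvw => hadj v w (K.toSimpleGraph_hom.map_adj hvw),
      fun v => hlist v⟩

end Correctness

/-! ### The number of rounds -/

lemma rounds_le {Δ J : ℕ} (hΔ : 3 ≤ Δ) (hJ : 1 ≤ J) : rounds Δ J ≤ 44 * (Δ ^ 2 * J ^ 2) := by
  obtain ⟨d, rfl⟩ := Nat.exists_eq_add_of_le hΔ
  obtain ⟨j, rfl⟩ := Nat.exists_eq_add_of_le hJ
  simp only [rounds, scheduleRounds, covering, separation, radius]
  ring_nf
  nlinarith

lemma log_two_add_one_le {n : ℕ} (hn : 4 ≤ n) : ((Nat.log 2 n + 1 : ℕ) : ℝ) ≤ 3 * Real.log n := by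
  have h1 : (Nat.log 2 n : ℝ) * Real.log 2 ≤ Real.log n := by
    rw [← Real.log_pow]
    refine Real.log_le_log (by positivity) ?_
    exact_mod_cast Nat.pow_log_le_self 2 (by omega)
  have h2 : (2 : ℝ) ≤ Nat.log 2 n := by
    exact_mod_cast (Nat.le_log_iff_pow_le (by norm_num) (by omega)).2 (by omega)
  have h3 := Real.log_two_gt_d9
  push_cast
  nlinarith

/-- The constant is `44 * 3 ^ 2 = 396`, rounded up. One factor `log n` is to spare. -/
lemma rounds_le_log {Δ n : ℕ} (hΔ : 3 ≤ Δ) (hn : 4 ≤ n) :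
    (rounds Δ (Nat.log 2 n + 1) : ℝ) ≤ 400 * (Δ : ℝ) ^ 2 * Real.log n ^ 3 := by
  have h1 : (rounds Δ (Nat.log 2 n + 1) : ℝ) ≤
      44 * ((Δ : ℝ) ^ 2 * ((Nat.log 2 n + 1 : ℕ) : ℝ) ^ 2) := by
    exact_mod_cast rounds_le hΔ (Nat.le_add_left 1 _)
  have h2 := log_two_add_one_le hn
  have hlog : 1 ≤ Real.log n := by
    have h3 : Real.log 4 ≤ Real.log n := Real.log_le_log (by norm_num) (by exact_mod_cast hn)
    have h4 : Real.log 4 = 2 * Real.log 2 := by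
      rw [show (4 : ℝ) = 2 ^ 2 by norm_num, Real.log_pow]; norm_num
    have h5 := Real.log_two_gt_d9
    linarith
  have h3 : ((Nat.log 2 n + 1 : ℕ) : ℝ) ^ 2 ≤ 9 * Real.log n ^ 3 := by
    calc ((Nat.log 2 n + 1 : ℕ) : ℝ) ^ 2 ≤ (3 * Real.log n) ^ 2 :=
          pow_le_pow_left₀ (Nat.cast_nonneg _) h2 2
      _ = 9 * Real.log n ^ 2 := by ring
      _ ≤ 9 * Real.log n ^ 3 := by
          have := pow_le_pow_right₀ hlog (show 2 ≤ 3 by norm_num)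
          linarith
  calc _ ≤ 44 * ((Δ : ℝ) ^ 2 * ((Nat.log 2 n + 1 : ℕ) : ℝ) ^ 2) := h1
    _ ≤ 44 * ((Δ : ℝ) ^ 2 * (9 * Real.log n ^ 3)) := by gcongr
    _ = 396 * ((Δ : ℝ) ^ 2 * Real.log n ^ 3) := by ring
    _ ≤ 400 * ((Δ : ℝ) ^ 2 * Real.log n ^ 3) := by
        gcongr
        norm_num
    _ = _ := by ring

end LocalBrooks

theorem corollary2p1 :
    ∃ C : ℝ, 0 < C ∧
      ∀ α : Type u,
        -- each node is given the number `Δ` and its own list of colours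
        ∃ A : LocalAlgorithm (ℕ × Finset α) (NodeOutput α),
          ∀ (V : Type v) [Fintype V] (G : SimpleGraph V) [DecidableRel G.Adj] (Δ : ℕ)
            (L : V → Finset α) (ident : V → ℕ),
            3 ≤ Δ → G.maxDegree = Δ → IsListAssignment Δ L → IsIdentAssignment ident →
            ∃ (T : ℕ) (out : V → NodeOutput α),
              (T : ℝ) ≤ C * (Δ : ℝ) ^ 2 * Real.log (Fintype.card V) ^ 3 ∧
              A.OutputsWithin G ident (fun w => (Δ, L w)) T out ∧
              -- a list-colouring is found, or it is found that there is none
              (FindsListColoring G L out ∨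
                (¬ IsListColorable G L ∧ ∃ w, out w = NodeOutput.noColoring)) ∧
              -- moreover, this holds in each connected component, with all of its nodes reporting
              ∀ K : G.ConnectedComponent,
                FindsListColoring K.toSimpleGraph (fun w => L w) (fun w => out w) ∨
                  (¬ IsListColorable K.toSimpleGraph (fun w => L w) ∧
                    ∀ w ∈ K, out w = NodeOutput.noColoring) := by
  refine ⟨400, by norm_num, fun α => ?_⟩
  obtain ⟨A, hA⟩ := LocalBrooks.exists_localAlgorithm.{u, v} (α := α)
    (fun n Δ => LocalBrooks.rounds Δ (Nat.log 2 n + 1))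
    (fun n Δ N => LocalBrooks.result N.G N.ident N.lists Δ (Nat.log 2 n + 1))
    (fun n Δ => LocalBrooks.isLocal_result Δ (Nat.log 2 n + 1))
  refine ⟨A, fun V _ G _ Δ L ident hΔ hmax hL hident => ?_⟩
  have hdeg : ∀ v, G.degree v ≤ Δ := fun v => hmax ▸ G.degree_le_maxDegree v
  have hn : 4 ≤ Fintype.card V := by
    have : Nonempty V := by
      by_contra h
      rw [not_nonempty_iff] at h
      have := G.maxDegree_of_subsingleton
      omega
    have := G.maxDegree_lt_card_verts
    omega
  have hJ : Fintype.card V < 2 ^ (Nat.log 2 (Fintype.card V) + 1) :=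
    Nat.lt_pow_succ_log_self (by norm_num) _
  have hcomp := LocalBrooks.result_component hident.1 hJ (fun v => (hident.2 v).2.trans_lt hJ)
    hΔ hdeg hL
  exact ⟨_, _, LocalBrooks.rounds_le_log hΔ hn, hA ⟨V, G, ident, L⟩ Δ,
    LocalBrooks.findsListColoring_or _ hcomp, hcomp⟩
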